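/- Let $\mathcal{H}$ be a complex Hilbert space (inner product linear in the second argument) with an antiunitary representation of $\mathbb{R}\times\{\pm 1\}$, i.e. a strongly continuous unitary one-parameter group $(U_t)_{t\in\mathbb{R}}$ and a conjugation $J$ (an antilinear isometric involution) with $JU_t=U_tJ$ for all $t\in\mathbb{R}$. Let $\mathcal{H}^\infty$ be the space of vectors with smooth orbit map, with the Fréchet topology given by the seminorms $\|\frac{d^n}{dt^n}|_{t=0}U_t\varphi\|$, $n\in\mathbb{N}_0$, and let $\mathcal{H}^{-\infty}$ be the space of continuous antilinear functionals on $\mathcal{H}^\infty$ (distribution vectors) with the weak-$*$ topology. We embed $\mathcal{H}\hookrightarrow\mathcal{H}^{-\infty}$ by $v\mapsto\langle\cdot,v\rangle$, and put $U^{-\infty}_t\eta=\eta\circ U_{-t}$ and $(J\eta)(\varphi)=\overline{\eta(J\varphi)}$. There is a unique spectral measure $P$ on $\mathbb{R}$ with $U_t=\int_{\mathbb{R}}e^{itp}\,dP(p)$ for all $t\in\mathbb{R}$. Put $A=\int_{\mathbb{R}} p\,dP(p)$, so that $U_t=e^{itA}$, and $P^v=\langle v,P(\cdot)v\rangle$ for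 $v\in\mathcal{H}$. Define $$\mathcal{H}^J_{\rm temp}=\{v\in\mathcal{H} : Jv=v,\ e^{\pi p}\,dP^v(p)\ \text{is a tempered measure}\},$$ and let $\mathcal{H}^{-\infty}_{\rm KMS}$ be the set of all $\eta\in\mathcal{H}^{-\infty}$ whose orbit map $t\mapsto U^{-\infty}_t\eta$ extends to a map $F$ on the closed strip $\{z\in\mathbb{C} : 0\le\operatorname{Im}z\le\pi\}$ with values in $\mathcal{H}^{-\infty}$ that is weak-$*$ continuous, weak-$*$ holomorphic on the interior, and satisfies $F(\pi i)=J\eta$. Then every $v\in\mathcal{H}^J_{\rm temp}$ lies in the domain of $e^{tA}$ for all $|t|<\pi/2$, the limit $$\beta^+(v)=\lim_{t\uparrow\pi/2}e^{tA}v$$ exists in $\mathcal{H}^{-\infty}$ in the weak-$*$ topology, and $\beta^+$ is a bijection from $\mathcal{H}^J_{\rm temp}$ onto $\mathcal{H}^{-\infty}_{\rm KMS}$. -/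

import Mathlib

open Set Filter Topology MeasureTheory
open scoped ContDiff ComplexConjugate

/-! ### Antiunitary representations of `ℝ × {±1}` -/

/-- A (continuous) antiunitary representation of `ℝ × {±1}` on `H`: a strongly continuous unitary
one-parameter group `U` and a conjugation `J` (an antiunitary involution, the image of `(0, -1)`)
commuting with every `U t`. -/
structure AntiunitaryRep (H : Type*) [NormedAddCommGroup H] [InnerProductSpace ℂ H] where
  U : ℝ → (H ≃ₗᵢ[ℂ] H)
  U_add : ∀ (s t : ℝ) (v : H), U (s + t) v = U s (U t v)
  continuous_orbit : ∀ v : H, Continuous fun t : ℝ => U t v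
  J : H ≃ₗᵢ⋆[ℂ] H
  J_J : ∀ v : H, J (J v) = v
  J_U : ∀ (t : ℝ) (v : H), J (U t v) = U t (J v)

namespace AntiunitaryRep

variable {H : Type*} [NormedAddCommGroup H] [InnerProductSpace ℂ H] (ρ : AntiunitaryRep H)

/-! ### Smooth vectors -/

/-- The subspace of vectors with smooth orbit map. -/
def smoothSubmodule : Submodule ℂ H where
  carrier := {v | ContDiff ℝ ∞ fun t : ℝ => ρ.U t v}
  zero_mem' := by
    simp only [mem_ofPred_eq, map_zero]
    exact contDiff_const
  add_mem' := by
    intro v w hv hw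
    simp only [mem_ofPred_eq, map_add] at *
    exact hv.add hw
  smul_mem' := by
    intro c v hv
    simp only [mem_ofPred_eq, map_smul] at *
    exact hv.const_smul c

/-- The space `H^∞` of smooth vectors. It is a type synonym, because it carries its own (Fréchet)
topology instead of the one induced by `H`. -/
def SmoothVectors : Type _ := ρ.smoothSubmodule

noncomputable instance : AddCommGroup ρ.SmoothVectors :=
  inferInstanceAs (AddCommGroup ρ.smoothSubmodule)

noncomputable instance : Module ℂ ρ.SmoothVectors :=
  inferInstanceAs (Module ℂ ρ.smoothSubmodule)

/-- The inclusion `H^∞ → H`. -/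
def smoothIncl : ρ.SmoothVectors →ₗ[ℂ] H := ρ.smoothSubmodule.subtype

theorem contDiff_orbit (φ : ρ.SmoothVectors) :
    ContDiff ℝ ∞ fun t : ℝ => ρ.U t (ρ.smoothIncl φ) := φ.2

/-- The `n`-th derivative at `0` of the orbit map, that is, `φ ↦ dU(d/dt)ⁿ φ`. -/
noncomputable def orbitDeriv (n : ℕ) : ρ.SmoothVectors →ₗ[ℂ] H where
  toFun φ := iteratedDeriv n (fun t : ℝ => ρ.U t (ρ.smoothIncl φ)) 0
  map_add' φ ψ := by
    have h := iteratedDeriv_fun_add (n := n) (x := (0 : ℝ))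
      ((ρ.contDiff_orbit φ).of_le (by exact_mod_cast le_top)).contDiffAt
      ((ρ.contDiff_orbit ψ).of_le (by exact_mod_cast le_top)).contDiffAt
    simpa only [map_add] using h
  map_smul' c φ := by
    have h := iteratedDeriv_fun_const_smul_field (n := n) (x := (0 : ℝ)) c
      (fun t : ℝ => ρ.U t (ρ.smoothIncl φ))
    simpa only [map_smul, RingHom.id_apply] using h

/-- The seminorms `φ ↦ ‖dU(d/dt)ⁿ φ‖` defining the topology of `H^∞`. -/
noncomputable def smoothSeminorm : SeminormFamily ℂ ρ.SmoothVectors ℕ :=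
  fun n => (normSeminorm ℂ H).comp (ρ.orbitDeriv n)

noncomputable instance : TopologicalSpace ρ.SmoothVectors :=
  ρ.smoothSeminorm.moduleFilterBasis.topology

theorem withSeminorms_smoothSeminorm : WithSeminorms ρ.smoothSeminorm := ⟨rfl⟩

instance : IsTopologicalAddGroup ρ.SmoothVectors :=
  ρ.withSeminorms_smoothSeminorm.topologicalAddGroup

instance : ContinuousSMul ℂ ρ.SmoothVectors :=
  ρ.withSeminorms_smoothSeminorm.continuousSMul

theorem smoothSeminorm_apply (n : ℕ) (φ : ρ.SmoothVectors) :
    ρ.smoothSeminorm n φ = ‖iteratedDeriv n (fun t : ℝ => ρ.U t (ρ.smoothIncl φ)) 0‖ := rfl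

/-- A semilinear map of `H^∞` that does not increase the defining seminorms is continuous. -/
theorem continuous_of_smoothSeminorm_le {σ : ℂ →+* ℂ} [RingHomIsometric σ]
    (f : ρ.SmoothVectors →ₛₗ[σ] ρ.SmoothVectors)
    (hf : ∀ n φ, ρ.smoothSeminorm n (f φ) ≤ ρ.smoothSeminorm n φ) : Continuous f := by
  refine ρ.withSeminorms_smoothSeminorm.continuous_of_continuous_comp f fun n => ?_
  refine Seminorm.continuous_of_le (ρ.withSeminorms_smoothSeminorm.continuous_seminorm n) ?_
  intro φ
  exact hf n φ

theorem U_U_comm (s t : ℝ) (v : H) : ρ.U s (ρ.U t v) = ρ.U t (ρ.U s v) := by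
  rw [← ρ.U_add, ← ρ.U_add, add_comm]

/-- The action `U^∞` of `ℝ` on the smooth vectors, as linear maps. -/
noncomputable def smoothULin (s : ℝ) : ρ.SmoothVectors →ₗ[ℂ] ρ.SmoothVectors where
  toFun φ := ⟨ρ.U s (ρ.smoothIncl φ), by
    change ContDiff ℝ ∞ fun t : ℝ => ρ.U t (ρ.U s (ρ.smoothIncl φ))
    simp only [fun t => ρ.U_U_comm t s]
    exact ((ρ.U s).toContinuousLinearEquiv.toContinuousLinearMap.restrictScalars ℝ).contDiff.comp
      (ρ.contDiff_orbit φ)⟩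
  map_add' φ ψ := by
    apply Subtype.ext
    exact map_add ((ρ.U s).toLinearEquiv.toLinearMap.comp ρ.smoothIncl) φ ψ
  map_smul' c φ := by
    apply Subtype.ext
    exact map_smul ((ρ.U s).toLinearEquiv.toLinearMap.comp ρ.smoothIncl) c φ

/-- The action `U^∞` of `ℝ` on the smooth vectors. -/
noncomputable def smoothU (s : ℝ) : ρ.SmoothVectors →L[ℂ] ρ.SmoothVectors where
  toLinearMap := ρ.smoothULin s
  cont := by
    refine ρ.continuous_of_smoothSeminorm_le (ρ.smoothULin s) fun n φ => le_of_eq ?_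
    rw [smoothSeminorm_apply, smoothSeminorm_apply, ← norm_iteratedFDeriv_eq_norm_iteratedDeriv,
      ← norm_iteratedFDeriv_eq_norm_iteratedDeriv]
    let g : H →ₗᵢ[ℝ] H := ⟨(ρ.U s).toLinearEquiv.toLinearMap.restrictScalars ℝ, (ρ.U s).norm_map⟩
    have h := LinearIsometry.norm_iteratedFDeriv_comp_left g (x := (0 : ℝ)) (i := n) (n := n)
      ((ρ.contDiff_orbit φ).of_le (by exact_mod_cast le_top)).contDiffAt le_rfl
    rw [← h]
    congr 2
    funext t
    exact ρ.U_U_comm t s _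

/-- The action of `J` on the smooth vectors, as an antilinear map. -/
noncomputable def smoothJLin : ρ.SmoothVectors →ₗ⋆[ℂ] ρ.SmoothVectors where
  toFun φ := ⟨ρ.J (ρ.smoothIncl φ), by
    change ContDiff ℝ ∞ fun t : ℝ => ρ.U t (ρ.J (ρ.smoothIncl φ))
    simp only [← ρ.J_U]
    let g : H →ₗᵢ[ℝ] H := ⟨⟨⟨ρ.J, map_add ρ.J⟩, fun c v => by
      simpa using map_smulₛₗ ρ.J (c : ℂ) v⟩, ρ.J.norm_map⟩
    exact g.contDiff.comp (ρ.contDiff_orbit φ)⟩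
  map_add' φ ψ := by
    apply Subtype.ext
    exact (congrArg ρ.J (map_add ρ.smoothIncl φ ψ)).trans (map_add ρ.J _ _)
  map_smul' c φ := by
    apply Subtype.ext
    exact (congrArg ρ.J (map_smul ρ.smoothIncl c φ)).trans (map_smulₛₗ ρ.J _ _)

/-- The action of `J` on the smooth vectors. -/
noncomputable def smoothJ : ρ.SmoothVectors →L⋆[ℂ] ρ.SmoothVectors where
  toLinearMap := ρ.smoothJLin
  cont := by
    refine ρ.continuous_of_smoothSeminorm_le ρ.smoothJLin fun n φ => le_of_eq ?_
    rw [smoothSeminorm_apply, smoothSeminorm_apply, ← norm_iteratedFDeriv_eq_norm_iteratedDeriv,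
      ← norm_iteratedFDeriv_eq_norm_iteratedDeriv]
    let g : H →ₗᵢ[ℝ] H := ⟨⟨⟨ρ.J, map_add ρ.J⟩, fun c v => by
      simpa using map_smulₛₗ ρ.J (c : ℂ) v⟩, ρ.J.norm_map⟩
    have h := LinearIsometry.norm_iteratedFDeriv_comp_left g (x := (0 : ℝ)) (i := n) (n := n)
      ((ρ.contDiff_orbit φ).of_le (by exact_mod_cast le_top)).contDiffAt le_rfl
    rw [← h]
    congr 2
    funext t
    exact (ρ.J_U t _).symm

/-! ### Distribution vectors -/

/-- The space `H^{-∞}` of distribution vectors, i.e. of continuous antilinear functionals on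
`H^∞`, with the weak-* topology (pointwise convergence on `H^∞`). -/
abbrev DistVectors : Type _ := ρ.SmoothVectors →SLₚₜ[starRingEnd ℂ] ℂ

/-- The embedding `H → H^{-∞}`, `v ↦ ⟨·, v⟩`. -/
noncomputable def embed (v : H) : ρ.DistVectors :=
  show ρ.SmoothVectors →L⋆[ℂ] ℂ from
  { toFun := fun φ => inner ℂ (ρ.smoothIncl φ) v
    map_add' := fun φ ψ => by rw [map_add, inner_add_left]
    map_smul' := fun c φ => by rw [map_smul, inner_smul_left, smul_eq_mul]
    cont := by
      have h : Continuous ρ.smoothIncl := by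
        refine ρ.withSeminorms_smoothSeminorm.continuous_normedSpace_rng H
          ρ.smoothIncl ⟨{0}, 1, fun φ => ?_⟩
        have h0 : ρ.U 0 (ρ.smoothIncl φ) = ρ.smoothIncl φ := by
          apply (ρ.U 0).injective
          rw [← ρ.U_add, add_zero]
        have h1 : ρ.smoothSeminorm 0 φ = ‖ρ.smoothIncl φ‖ := by
          rw [smoothSeminorm_apply, iteratedDeriv_zero, h0]
        simp [h1]
      exact h.inner continuous_const }

/-- The representation `U^{-∞}` on distribution vectors, `U^{-∞}(t) η = η ∘ U^∞(-t)`. -/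
noncomputable def distU (t : ℝ) (η : ρ.DistVectors) : ρ.DistVectors :=
  show ρ.SmoothVectors →L⋆[ℂ] ℂ from
  ContinuousLinearMap.comp (show ρ.SmoothVectors →L⋆[ℂ] ℂ from η) (ρ.smoothU (-t))

/-- The action of `J` on distribution vectors, `(J η)(φ) = conj (η (J φ))`. -/
noncomputable def distJ (η : ρ.DistVectors) : ρ.DistVectors :=
  show ρ.SmoothVectors →L⋆[ℂ] ℂ from
  { toFun := fun φ => conj (η (ρ.smoothJ φ))
    map_add' := fun φ ψ => by rw [map_add, map_add, map_add]
    map_smul' := fun c φ => by rw [map_smulₛₗ, map_smulₛₗ, smul_eq_mul, map_mul]; simp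
    cont := Complex.continuous_conj.comp
      ((show ρ.SmoothVectors →L⋆[ℂ] ℂ from η).continuous.comp ρ.smoothJ.continuous) }

@[simp] theorem embed_apply (v : H) (φ : ρ.SmoothVectors) :
    ρ.embed v φ = inner ℂ (ρ.smoothIncl φ) v := rfl

@[simp] theorem distU_apply (t : ℝ) (η : ρ.DistVectors) (φ : ρ.SmoothVectors) :
    ρ.distU t η φ = η (ρ.smoothU (-t) φ) := rfl

@[simp] theorem distJ_apply (η : ρ.DistVectors) (φ : ρ.SmoothVectors) :
    ρ.distJ η φ = conj (η (ρ.smoothJ φ)) := rfl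

/-- The actions on `H^{-∞}` extend those on `H`. -/
theorem distU_embed (t : ℝ) (v : H) : ρ.distU t (ρ.embed v) = ρ.embed (ρ.U t v) := by
  apply ContinuousLinearMap.ext
  intro φ
  change inner ℂ (ρ.U (-t) (ρ.smoothIncl φ)) v = inner ℂ (ρ.smoothIncl φ) (ρ.U t v)
  rw [← (ρ.U t).inner_map_map, ← ρ.U_add, add_neg_cancel]
  congr 1
  apply (ρ.U 0).injective
  rw [← ρ.U_add, add_zero]

theorem distJ_embed (v : H) : ρ.distJ (ρ.embed v) = ρ.embed (ρ.J v) := by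
  have key : ∀ x y : H, inner ℂ (ρ.J x) (ρ.J y) = inner ℂ y x := by
    intro x y
    have hI : ∀ u : H, ρ.J (Complex.I • u) = -(Complex.I • ρ.J u) := fun u => by
      simp [map_smulₛₗ]
    have n1 : ‖ρ.J x + ρ.J y‖ = ‖y + x‖ := by rw [← map_add, ρ.J.norm_map, add_comm]
    have n2 : ‖ρ.J x - ρ.J y‖ = ‖y - x‖ := by rw [← map_sub, ρ.J.norm_map, norm_sub_rev]
    have n3 : ‖ρ.J x - Complex.I • ρ.J y‖ = ‖y - Complex.I • x‖ := by
      have : ρ.J x - Complex.I • ρ.J y = ρ.J (x + Complex.I • y) := by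
        rw [map_add, hI, sub_eq_add_neg]
      rw [this, ρ.J.norm_map]
      have e : x + Complex.I • y = Complex.I • (y - Complex.I • x) := by
        rw [smul_sub, smul_smul, Complex.I_mul_I, neg_one_smul]; abel
      rw [e, norm_smul]; simp
    have n4 : ‖ρ.J x + Complex.I • ρ.J y‖ = ‖y + Complex.I • x‖ := by
      have : ρ.J x + Complex.I • ρ.J y = ρ.J (x - Complex.I • y) := by
        rw [map_sub, hI, sub_neg_eq_add]
      rw [this, ρ.J.norm_map]
      have e : x - Complex.I • y = (-Complex.I) • (y + Complex.I • x) := by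
        rw [smul_add, smul_smul, neg_mul, Complex.I_mul_I, neg_neg, one_smul, neg_smul]; abel
      rw [e, norm_smul]; simp
    rw [inner_eq_sum_norm_sq_div_four, inner_eq_sum_norm_sq_div_four (𝕜 := ℂ) y x]
    simp only [RCLike.I_to_complex]
    rw [n1, n2, n3, n4]
  apply ContinuousLinearMap.ext
  intro φ
  change conj (inner ℂ (ρ.J (ρ.smoothIncl φ)) v) = inner ℂ (ρ.smoothIncl φ) (ρ.J v)
  rw [inner_conj_symm, ← key, ρ.J_J]

/-- The space `H^{-∞}_KMS` of distribution vectors `η` whose orbit map `t ↦ U^{-∞}(t) η` extends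
weak-* continuously to the closed strip `0 ≤ Im z ≤ π`, weak-* holomorphic in the interior, with
value `J η` at `πi`. -/
def kmsVectors : Set ρ.DistVectors :=
  {η | ∃ F : ℂ → ρ.DistVectors,
    ContinuousOn F {z | 0 ≤ z.im ∧ z.im ≤ Real.pi} ∧
    (∀ φ : ρ.SmoothVectors,
      DifferentiableOn ℂ (fun z => F z φ) {z | 0 < z.im ∧ z.im < Real.pi}) ∧
    (∀ t : ℝ, F (t : ℂ) = ρ.distU t η) ∧
    F (Real.pi * Complex.I) = ρ.distJ η}

end AntiunitaryRep

/-! ### Spectral measures -/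

/-- A spectral (projection-valued) measure on the Borel sets of `ℝ`. As for Mathlib's vector
measures, the value on non-measurable sets is `0` by convention. -/
structure SpectralMeasure (H : Type*) [NormedAddCommGroup H] [InnerProductSpace ℂ H]
    [CompleteSpace H] where
  proj : Set ℝ → (H →L[ℂ] H)
  isStarProjection : ∀ E, IsStarProjection (proj E)
  proj_univ : proj univ = 1
  proj_not_measurable : ∀ E, ¬ MeasurableSet E → proj E = 0
  hasSum_proj : ∀ E : ℕ → Set ℝ, (∀ i, MeasurableSet (E i)) → Pairwise (Function.onFun Disjoint E) →
    ∀ v, HasSum (fun i => proj (E i) v) (proj (⋃ i, E i) v)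

namespace SpectralMeasure

variable {H : Type*} [NormedAddCommGroup H] [InnerProductSpace ℂ H] [CompleteSpace H]
  (P : SpectralMeasure H)

theorem re_inner_proj_nonneg (E : Set ℝ) (v : H) : 0 ≤ (inner ℂ v (P.proj E v)).re := by
  have h := P.isStarProjection E
  have h1 : P.proj E v = P.proj E (P.proj E v) := by
    conv_lhs => rw [← h.isIdempotentElem.eq]
    rfl
  have h2 := h.isSelfAdjoint.isSymmetric v (P.proj E v)
  simp only [ContinuousLinearMap.coe_coe] at h2
  rw [h1, ← h2]
  exact inner_self_nonneg (𝕜 := ℂ)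

theorem proj_empty : P.proj ∅ = 0 := by
  ext v
  have h := (P.hasSum_proj (fun _ => ∅) (fun _ => MeasurableSet.empty)
    (fun _ _ _ => disjoint_bot_left) v).summable
  simpa using (summable_const_iff (P.proj ∅ v)).mp h

/-- The finite measure `P^v = ⟨v, P(·) v⟩`. -/
noncomputable def measure (v : H) : Measure ℝ :=
  Measure.ofMeasurable (fun E _ => ENNReal.ofReal (inner ℂ v (P.proj E v)).re)
    (by simp [P.proj_empty])
    (by
      intro E hE hd
      have h1 : HasSum (fun i => (inner ℂ v (P.proj (E i) v)).re)
          (inner ℂ v (P.proj (⋃ i, E i) v)).re := by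
        have h := P.hasSum_proj E hE hd v
        exact Complex.hasSum_re (h.mapL (innerSL ℂ v))
      rw [← h1.tsum_eq, ENNReal.ofReal_tsum_of_nonneg
        (fun i => P.re_inner_proj_nonneg _ v) h1.summable])

theorem measure_apply (v : H) {E : Set ℝ} (hE : MeasurableSet E) :
    P.measure v E = ENNReal.ofReal (inner ℂ v (P.proj E v)).re :=
  Measure.ofMeasurable_apply E hE

/-- The integral `∫ s dP v = ∑ y, y P(s = y) v` of a simple function `s`. -/
noncomputable def simpleIntegral (s : SimpleFunc ℝ ℂ) (v : H) : H :=
  ∑ y ∈ s.range, y • P.proj (s ⁻¹' {y}) v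

/-- `v` lies in the domain of the normal operator `∫ f dP`, that is, `f ∈ L²(P^v)`. -/
def MemDomain (f : ℝ → ℂ) (v : H) : Prop := MemLp f 2 (P.measure v)

/-- `w = (∫ f dP) v`: there are simple functions `sₙ` converging to `f` in `L²(P^v)` for which the
vectors `∫ sₙ dP v` converge to `w`. -/
def IsIntegral (f : ℝ → ℂ) (v w : H) : Prop :=
  ∃ s : ℕ → SimpleFunc ℝ ℂ,
    Tendsto (fun n => eLpNorm (fun p => s n p - f p) 2 (P.measure v)) atTop (𝓝 0) ∧
    Tendsto (fun n => P.simpleIntegral (s n) v) atTop (𝓝 w)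

open Classical in
/-- The vector `(∫ f dP) v`, for `v` in the domain (and `0` otherwise). -/
noncomputable def integral (f : ℝ → ℂ) (v : H) : H :=
  if h : P.MemDomain f v ∧ ∃ w, P.IsIntegral f v w then h.2.choose else 0

/-- `P` is a spectral measure of the one-parameter group: `U_t = ∫ e^{itp} dP(p)` for all `t`. -/
def Represents (ρ : AntiunitaryRep H) : Prop :=
  ∀ (t : ℝ) (v : H), P.IsIntegral (fun p => Complex.exp (Complex.I * t * p)) v (ρ.U t v)

/-- `v` lies in the domain of `e^{tA}`, where `A = ∫ p dP(p)`. -/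
def MemDomainExp (t : ℝ) (v : H) : Prop := P.MemDomain (fun p => Complex.exp (t * p)) v

/-- The vector `e^{tA} v`, where `A = ∫ p dP(p)`. -/
noncomputable def expA (t : ℝ) (v : H) : H := P.integral (fun p => Complex.exp (t * p)) v

/-- The set `H^J_temp` of all `J`-fixed vectors `v` for which the measure `e^{πp} dP^v(p)` is
tempered, i.e. integrates `(1 + |p|)^{-n}` for some `n`. -/
def tempVectors (ρ : AntiunitaryRep H) : Set H :=
  {v | ρ.J v = v ∧
    ((P.measure v).withDensity
      fun p => ENNReal.ofReal (Real.exp (Real.pi * p))).HasTemperateGrowth}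

/-- The boundary value `β⁺(v) = lim_{t ↑ π/2} e^{tA} v`, a weak-* limit in `H^{-∞}`. -/
noncomputable def betaPlus (ρ : AntiunitaryRep H) (v : H) : ρ.DistVectors :=
  limUnder (𝓝[<] (Real.pi / 2)) (fun t : ℝ => ρ.embed (P.expA t v))

end SpectralMeasure

/-!
The theorem is a statement about the spectral calculus of the generator `A`, and everything is
read off from the measures `P^v` and from the isometries of `L²(P^v)` into `H` that send
`p ↦ exp (itp)` to `U_t v`.

*Spectral measure.* The function `t ↦ ⟨v, U_t v⟩` is positive definite. Its Gaussian
regularisations have nonnegative Fourier transforms (`fourier_gaussian_inner_U_nonneg`), hence are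
characteristic functions of finite measures, and tightness gives a finite measure `P^v` with
characteristic function `t ↦ ⟨v, U_t v⟩` (`exists_measure_charFun`). Trigonometric polynomials are
dense in `L²` of a finite measure (`exists_trig_tendsto`), so that `exp (itp) ↦ U_t v` extends to
an isometry of `L²(P^v)`; this defines `f(A) v` for `f ∈ L²(P^v)` (`AntiunitaryRep.fc`). Linearity,
multiplicativity, adjoints and `J f(A) v = f̃(A) J v` with `f̃(p) = conj (f (-p))` hold for
trigonometric polynomials and pass to the limit. The projections `1_E(A)` form the spectral measure,
and it is unique because finite measures are determined by their characteristic functions.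

*Distribution vectors.* Smooth vectors are those in the domain of all powers of `A`, and the
seminorms are `‖Aⁿ φ‖`. Hence every distribution vector is of the form `(1 - iA)ⁿ u` with `u ∈ H`
(`exists_eq_wtDist`), where `((1 - iA)ⁿ u)(φ) = ⟨(1 + iA)ⁿ φ, u⟩`, and `u` is unique for given `n`.

*From `v` to `β⁺(v)`.* As `J A J = -A`, the measure `P^v` of a `J`-fixed vector is symmetric, and
`exp (πp) dP^v(p)` is tempered if and only if `exp (sp) (1 - ip)⁻ⁿ` is in `L²(P^v)` for some `n` and
all `|Re s| ≤ π/2`. Dominated convergence then shows that the vectors `exp (sA) (1 - iA)⁻ⁿ v` depend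
continuously on `s` in this strip and holomorphically on `s` in its interior. So
`β⁺(v) = (1 - iA)ⁿ (exp (πA/2) (1 - iA)⁻ⁿ v)`, and `z ↦ exp ((π/2 + iz) A) v` is the extension of
the orbit map of `β⁺(v)`, with value `exp (-πA/2) v = J β⁺(v)` at `πi`.

*From `η` to `v`.* Let `η = (1 - iA)ⁿ u` be a KMS vector. Paired with vectors of bounded spectral
support, the orbit map of `η` has an entire extension, which agrees with the given one on the strip
by uniqueness of boundary values (`eqOn_zero_of_eq_zero_on_real`). At `πi` this gives
`J u = exp (-πA) u`. So both `1` and `exp (-2πp)` are integrable with respect to `P^u`, hence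
`u` lies in the domain of `(1 - iA)ⁿ exp (-πA/2)`, and `v = (1 - iA)ⁿ exp (-πA/2) u` is the required
preimage: `J v = (1 - iA)ⁿ exp (πA/2) J u = v`.
-/

/-! ### Bochner's theorem for the one-parameter group -/

open scoped FourierTransform RealInnerProductSpace in
/-- A continuous integrable function on the line whose Fourier transform is nonnegative has an
integrable Fourier transform: test against wider and wider Gaussians. -/
theorem integrable_fourier_of_nonneg {f : ℝ → ℂ} (hc : Continuous f) (hf : Integrable f)
    (hnn : ∀ p, ∃ r : ℝ, 0 ≤ r ∧ 𝓕 f p = r) : Integrable (𝓕 f) := by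
  have hcont : Continuous (𝓕 f) := by
    have := VectorFourier.fourierIntegral_continuous (L := innerₗ ℝ) Real.continuous_fourierChar
      (by exact continuous_inner) hf
    exact this
  choose F hF0 hF using hnn
  have hFn : ∀ p, ‖𝓕 f p‖ = F p := fun p => by
    rw [hF, Complex.norm_real, Real.norm_of_nonneg (hF0 p)]
  -- the Gaussian averages of `𝓕 f` converge to `f 0`
  have hlim : Tendsto (fun c : ℝ => ∫ w : ℝ, Complex.exp (-c⁻¹ * ‖w‖ ^ 2) • 𝓕 f w)
      atTop (𝓝 (f 0)) := by
    refine (Real.tendsto_integral_gaussian_smul' hf (v := 0) hc.continuousAt).congr' ?_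
    filter_upwards [Ioi_mem_atTop 0] with c (hc : 0 < c)
    have J : Integrable (fun w : ℝ ↦
        Complex.exp (- c⁻¹ * ‖w‖ ^ 2 + 2 * Real.pi * Complex.I * (inner ℝ (0 : ℝ) w : ℝ))) :=
      GaussianFourier.integrable_cexp_neg_mul_sq_norm_add (by simpa) _ _
    have h := (VectorFourier.integral_fourierIntegral_smul_eq_flip (L := innerₗ ℝ)
      Real.continuous_fourierChar continuous_inner J hf)
    have h2 : ∀ w : ℝ, 𝓕 (fun w : ℝ ↦ Complex.exp (- c⁻¹ * ‖w‖ ^ 2 +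
        2 * Real.pi * Complex.I * (inner ℝ (0 : ℝ) w : ℝ))) w =
        (Real.pi * c : ℂ) ^ (Module.finrank ℝ ℝ / 2 : ℂ) *
          Complex.exp (-Real.pi ^ 2 * c * ‖0 - w‖ ^ 2) := by
      intro w
      rw [fourier_gaussian_innerProductSpace' (by simpa)]
      congr
      · simp
      · simp
        ring_nf
    simp only [← h2]
    refine Eq.trans ?_ (h.trans ?_)
    · rfl
    · congr 1
      funext w
      simp only [inner_zero_left, Complex.ofReal_zero, mul_zero, add_zero]
      simp
      rfl
  have hcov : AECover (volume : Measure ℝ) atTop (fun n : ℕ => Icc (-(n : ℝ)) n) :=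
    aecover_Icc (tendsto_neg_atTop_atBot.comp tendsto_natCast_atTop_atTop)
      tendsto_natCast_atTop_atTop
  have hint : ∀ c : ℝ, 0 < c → Integrable (fun w : ℝ => Real.exp (-c⁻¹ * w ^ 2) * F w) := by
    intro c hc
    have hb : ∀ p, F p ≤ ∫ t, ‖f t‖ := fun p => by
      rw [← hFn]; exact VectorFourier.norm_fourierIntegral_le_integral_norm _ _ _ _ _
    have hFm : Continuous F := by
      have : F = fun p => ‖𝓕 f p‖ := funext fun p => (hFn p).symm
      rw [this]; exact hcont.norm
    refine ((integrable_exp_neg_mul_sq (inv_pos.2 hc)).mul_const (∫ t, ‖f t‖)).mono'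
      (by fun_prop) (ae_of_all _ fun p => ?_)
    rw [Real.norm_of_nonneg (mul_nonneg (Real.exp_pos _).le (hF0 p))]
    exact mul_le_mul_of_nonneg_left (hb p) (Real.exp_pos _).le
  have hlim2 : Tendsto (fun n : ℕ => ∫ w : ℝ, Real.exp (-((n : ℝ) ^ 2)⁻¹ * w ^ 2) * F w)
      atTop (𝓝 (f 0).re) := by
    have hsq : Tendsto (fun n : ℕ => ((n : ℝ) ^ 2)) atTop atTop :=
      (tendsto_pow_atTop two_ne_zero).comp tendsto_natCast_atTop_atTop
    have := (Complex.continuous_re.tendsto _).comp (hlim.comp hsq)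
    refine this.congr' (Eventually.of_forall fun n => ?_)
    simp only [Function.comp_apply]
    have : ∀ w : ℝ, Complex.exp (-((((n : ℝ) ^ 2)⁻¹ : ℝ) : ℂ) * (‖w‖ : ℂ) ^ 2) • 𝓕 f w =
        ((Real.exp (-((n : ℝ) ^ 2)⁻¹ * w ^ 2) * F w : ℝ) : ℂ) := fun w => by
      rw [hF, smul_eq_mul]
      push_cast
      rw [← Complex.ofReal_pow ‖w‖, Real.norm_eq_abs, sq_abs]
      push_cast
      rfl
    simp only [Complex.ofReal_inv] at this ⊢
    simp only [this]
    rw [integral_complex_ofReal, Complex.ofReal_re]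
  refine hcov.integrable_of_integral_norm_bounded (Real.exp 1 * ((f 0).re + 1))
    (fun n => (hcont.integrableOn_Icc)) ?_
  filter_upwards [hlim2.eventually (gt_mem_nhds (lt_add_one _)), eventually_gt_atTop 0]
    with n hn hn0
  have hn1 : (0 : ℝ) < (n : ℝ) ^ 2 := by positivity
  refine le_trans ?_ (mul_le_mul_of_nonneg_left hn.le (Real.exp_pos 1).le)
  rw [← integral_const_mul]
  refine (setIntegral_mono_on hcont.norm.integrableOn_Icc ((hint _ hn1).const_mul _).integrableOn
    measurableSet_Icc fun w hw => ?_).trans (setIntegral_le_integral ((hint _ hn1).const_mul _)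
      (ae_of_all _ fun w => ?_))
  · rw [hFn, ← mul_assoc, ← Real.exp_add]
    refine le_mul_of_one_le_left (hF0 w) (Real.one_le_exp ?_)
    have : w ^ 2 ≤ (n : ℝ) ^ 2 := sq_le_sq' hw.1 hw.2
    have : ((n : ℝ) ^ 2)⁻¹ * w ^ 2 ≤ 1 := by
      rw [inv_mul_le_iff₀ hn1]; simpa using this
    linarith
  · exact mul_nonneg (Real.exp_pos _).le (mul_nonneg (Real.exp_pos _).le (hF0 w))

open scoped FourierTransform RealInnerProductSpace in
/-- A continuous integrable function with nonnegative Fourier transform is a characteristic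
function. -/
theorem exists_measure_charFun_of_fourier_nonneg {f : ℝ → ℂ} (hc : Continuous f)
    (hf : Integrable f) (hnn : ∀ p, ∃ r : ℝ, 0 ≤ r ∧ 𝓕 f p = r) :
    ∃ μ : Measure ℝ, IsFiniteMeasure μ ∧ ∀ t, charFun μ t = f t := by
  have hF := integrable_fourier_of_nonneg hc hf hnn
  choose F hF0 hFF using hnn
  have hFint : Integrable F := by
    have : F = fun p => (𝓕 f p).re := funext fun p => by rw [hFF, Complex.ofReal_re]
    rw [this]; exact hF.re
  have hFm : AEMeasurable (fun p => ENNReal.ofReal (F p)) volume :=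
    hFint.aestronglyMeasurable.aemeasurable.ennreal_ofReal
  have hfin : IsFiniteMeasure (volume.withDensity fun p => ENNReal.ofReal (F p)) :=
    isFiniteMeasure_withDensity_ofReal hFint.2
  -- `𝓕` uses the kernel `exp (-2πipt)`, `charFun` the kernel `exp (ipt)`
  refine ⟨(volume.withDensity fun p => ENNReal.ofReal (F p)).map (2 * Real.pi * ·),
    Measure.isFiniteMeasure_map _ _, fun t => ?_⟩
  rw [charFun_map_mul, charFun_apply_real, integral_withDensity_eq_integral_toReal_smul₀ hFm
    (ae_of_all _ fun _ => ENNReal.ofReal_lt_top)]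
  have := congrFun (hc.fourierInv_fourier_eq hf hF) t
  rw [← this, Real.fourierInv_eq']
  congr 1
  funext p
  rw [ENNReal.toReal_ofReal (hF0 p), hFF, smul_eq_mul, mul_comm, Complex.real_smul, mul_comm]
  congr 2
  simp
  ring

namespace AntiunitaryRep

variable {H : Type*} [NormedAddCommGroup H] [InnerProductSpace ℂ H] (ρ : AntiunitaryRep H)

theorem U_zero (v : H) : ρ.U 0 v = v := by
  apply (ρ.U 0).injective
  rw [← ρ.U_add, add_zero]

theorem inner_U_U (s t : ℝ) (x y : H) :
    inner ℂ (ρ.U s x) (ρ.U t y) = inner ℂ x (ρ.U (t - s) y) := by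
  rw [← (ρ.U s).inner_map_map x, ← ρ.U_add, add_sub_cancel]

theorem continuous_inner_U (x y : H) : Continuous fun t => inner ℂ x (ρ.U t y) :=
  continuous_const.inner (ρ.continuous_orbit y)

open scoped FourierTransform in
/-- The Fourier transform of the regularised positive definite function
`t ↦ exp (-bt²) ⟨v, U_t v⟩` is nonnegative, because up to a positive factor it is the squared norm
of the vector `∫ exp (-2bs²) exp (-2πips) U_s v ds`. -/
theorem fourier_gaussian_inner_U_nonneg [CompleteSpace H] (v : H) {b : ℝ} (hb : 0 < b) (p : ℝ) :
    ∃ r : ℝ, 0 ≤ r ∧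
      𝓕 (fun t : ℝ => (Real.exp (-b * t ^ 2) : ℂ) * inner ℂ v (ρ.U t v)) p = r := by
  set a : ℝ → ℂ := fun s => (Real.exp (-(2 * b) * s ^ 2) : ℂ) *
    Complex.exp (-2 * Real.pi * p * s * Complex.I) with ha
  have han : ∀ s, ‖a s‖ = Real.exp (-(2 * b) * s ^ 2) := fun s => by
    rw [ha]; simp only [norm_mul, Complex.norm_real, Complex.norm_exp]
    simp
  have hac : Continuous a := by fun_prop
  have hint : Integrable fun s => a s • ρ.U s v := by
    refine ((integrable_exp_neg_mul_sq (b := 2 * b) (by positivity)).mul_const ‖v‖).mono'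
      (hac.smul (ρ.continuous_orbit v)).aestronglyMeasurable (ae_of_all _ fun s => ?_)
    rw [norm_smul, (ρ.U s).norm_map, han]
  set w : H := ∫ s, a s • ρ.U s v with hw
  have hψ : Continuous fun t => inner ℂ v (ρ.U t v) := ρ.continuous_inner_U v v
  -- `⟨U_s v, w⟩` by translation of the integration variable
  have h1 : ∀ s, inner ℂ (ρ.U s v) w = ∫ t, a (s + t) * inner ℂ v (ρ.U t v) := by
    intro s
    rw [hw, ← integral_inner hint]
    rw [← integral_add_left_eq_self _ s]
    congr 1
    funext t
    rw [inner_smul_right, inner_U_U, add_sub_cancel_left]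
  have h2 : inner ℂ w w = ∫ s, ∫ t, conj (a s) * (a (s + t) * inner ℂ v (ρ.U t v)) := by
    conv_lhs => rw [hw, ← inner_conj_symm, ← integral_inner hint, ← integral_conj]
    congr 1
    funext s
    rw [inner_conj_symm, inner_smul_left, h1, integral_const_mul]
  have hK : ∀ s t : ℝ, conj (a s) * a (s + t) = ((Real.exp (-(4 * b) * (s + t / 2) ^ 2) : ℝ) : ℂ) *
      ((Real.exp (-b * t ^ 2) : ℂ) * Complex.exp (-2 * Real.pi * t * p * Complex.I)) := by
    intro s t
    simp only [ha, ← Complex.exp_conj, Complex.ofReal_exp, ← Complex.exp_add]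
    congr 1
    simp [map_ofNat]
    ring_nf
  have hprod : Integrable (Function.uncurry fun s t : ℝ =>
      conj (a s) * (a (s + t) * inner ℂ v (ρ.U t v))) (volume.prod volume) := by
    have hg := integrable_exp_neg_mul_sq (b := 2 * b / 3) (by positivity)
    refine ((hg.mul_prod hg).mul_const (‖v‖ * ‖v‖)).mono' ?_ (ae_of_all _ fun z => ?_)
    · apply Continuous.aestronglyMeasurable
      simp only [Function.uncurry_def]
      exact (Complex.continuous_conj.comp (hac.comp continuous_fst)).mul
        ((hac.comp (continuous_fst.add continuous_snd)).mul (hψ.comp continuous_snd))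
    · simp only [Function.uncurry_def, norm_mul, RCLike.norm_conj, han]
      rw [← mul_assoc, ← Real.exp_add, ← Real.exp_add]
      refine mul_le_mul (Real.exp_le_exp.2 ?_) ?_ (norm_nonneg _) (Real.exp_pos _).le
      · -- `s² + (s + t)² ≥ (s² + t²) / 3` makes the double integral absolutely convergent
        nlinarith [mul_nonneg hb.le (sq_nonneg (z.1 * 2 + z.2 * 3 / 2)),
          mul_nonneg hb.le (sq_nonneg z.2)]
      · refine (norm_inner_le_norm _ _).trans ?_
        rw [(ρ.U _).norm_map]
  have h3 : inner ℂ w w = ((∫ s : ℝ, Real.exp (-(4 * b) * s ^ 2) : ℝ) : ℂ) *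
      𝓕 (fun t : ℝ => (Real.exp (-b * t ^ 2) : ℂ) * inner ℂ v (ρ.U t v)) p := by
    rw [h2, integral_integral_swap hprod, Real.fourier_real_eq_integral_exp_smul,
      ← integral_const_mul]
    congr 1
    funext t
    simp_rw [← mul_assoc, hK, mul_assoc]
    rw [integral_mul_const, ← integral_complex_ofReal,
      integral_add_right_eq_self (μ := volume)
        (fun s : ℝ => ((Real.exp (-(4 * b) * s ^ 2) : ℝ) : ℂ)) (t / 2)]
    congr 1
    rw [smul_eq_mul]
    push_cast
    ring_nf
  have hC : 0 < ∫ s : ℝ, Real.exp (-(4 * b) * s ^ 2) := by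
    rw [integral_gaussian]; positivity
  refine ⟨‖w‖ ^ 2 / ∫ s : ℝ, Real.exp (-(4 * b) * s ^ 2), by positivity, ?_⟩
  rw [inner_self_eq_norm_sq_to_K] at h3
  rw [Complex.ofReal_div, eq_div_iff (Complex.ofReal_ne_zero.2 hC.ne'), mul_comm, ← h3]
  simp

/-- **Bochner's theorem** for the positive definite functions `t ↦ ⟨v, U_t v⟩`, first for unit
vectors: the Gaussian regularisations are characteristic functions of probability measures, and
these converge along an ultrafilter by tightness. -/
theorem exists_measure_charFun_of_norm_eq_one [CompleteSpace H] (v : H) (hv : ‖v‖ = 1) :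
    ∃ μ : Measure ℝ, IsFiniteMeasure μ ∧ ∀ t, charFun μ t = inner ℂ v (ρ.U t v) := by
  have hb : ∀ n : ℕ, (0 : ℝ) < 1 / ((n : ℝ) + 1) := fun n => by positivity
  have hex : ∀ n : ℕ, ∃ μ : Measure ℝ, IsFiniteMeasure μ ∧ ∀ t, charFun μ t =
      (Real.exp (-(1 / ((n : ℝ) + 1)) * t ^ 2) : ℂ) * inner ℂ v (ρ.U t v) := by
    intro n
    have hψ := ρ.continuous_inner_U v v
    refine exists_measure_charFun_of_fourier_nonneg (by fun_prop) ?_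
      (ρ.fourier_gaussian_inner_U_nonneg v (hb n))
    refine (integrable_exp_neg_mul_sq (hb n)).mono' (by fun_prop) (ae_of_all _ fun t => ?_)
    rw [norm_mul, Complex.norm_real, Real.norm_of_nonneg (Real.exp_pos _).le]
    refine mul_le_of_le_one_right (Real.exp_pos _).le ((norm_inner_le_norm _ _).trans ?_)
    rw [(ρ.U _).norm_map, hv, one_mul]
  choose μ hμf hμ using hex
  have hprob : ∀ n, IsProbabilityMeasure (μ n) := by
    intro n
    have h := hμ n 0
    rw [charFun_zero, ρ.U_zero, inner_self_eq_norm_sq_to_K, hv] at h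
    have h1 : (μ n).real univ = 1 := by
      have : (((μ n).real univ : ℝ) : ℂ) = 1 := by rw [h]; simp
      exact_mod_cast this
    exact isProbabilityMeasure_iff_real.2 h1
  have hlim : ∀ t, Tendsto (fun n => charFun (μ n) t) atTop (𝓝 (inner ℂ v (ρ.U t v))) := by
    intro t
    simp only [hμ]
    have h0 : Tendsto (fun n : ℕ => Real.exp (-(1 / ((n : ℝ) + 1)) * t ^ 2)) atTop (𝓝 1) := by
      have := (Real.continuous_exp.tendsto 0).comp
        (by simpa using (tendsto_one_div_add_atTop_nhds_zero_nat (𝕜 := ℝ)).neg.mul_const (t ^ 2))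
      simpa [Function.comp_def] using this
    simpa using ((Complex.continuous_ofReal.tendsto _).comp h0).mul_const (inner ℂ v (ρ.U t v))
  have htight := isTightMeasureSet_of_tendsto_charFun (μ := μ)
    (ρ.continuous_inner_U v v).continuousAt hlim
  let ν : ℕ → ProbabilityMeasure ℝ := fun n => ⟨μ n, hprob n⟩
  have hcomp : IsCompact (closure (range ν)) := by
    refine isCompact_closure_of_isTightMeasureSet ?_
    convert htight using 1
    ext m
    constructor
    · rintro ⟨_, ⟨n, rfl⟩, rfl⟩
      exact ⟨n, rfl⟩
    · rintro ⟨n, rfl⟩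
      exact ⟨ν n, ⟨n, rfl⟩, rfl⟩
  let W : Ultrafilter ℕ := Ultrafilter.of atTop
  have hW : (W : Filter ℕ) ≤ atTop := Ultrafilter.of_le atTop
  obtain ⟨ν', -, hν'⟩ := hcomp.ultrafilter_le_nhds (W.map ν)
    (le_principal_iff.2 (mem_map.2 (univ_mem' fun n => subset_closure ⟨n, rfl⟩)))
  refine ⟨ν', inferInstance, fun t => ?_⟩
  have hν : Tendsto ν W (𝓝 ν') := hν'
  rw [ProbabilityMeasure.tendsto_iff_forall_integral_rclike_tendsto ℂ] at hν
  refine tendsto_nhds_unique ?_ ((hlim t).mono_left hW)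
  simp_rw [charFun_eq_integral_innerProbChar]
  exact hν (BoundedContinuousFunction.innerProbChar t)

theorem exists_measure_charFun [CompleteSpace H] (v : H) :
    ∃ μ : Measure ℝ, IsFiniteMeasure μ ∧ ∀ t, charFun μ t = inner ℂ v (ρ.U t v) := by
  rcases eq_or_ne v 0 with rfl | hv
  · exact ⟨0, inferInstance, fun t => by simp⟩
  have hv' : (‖v‖ : ℂ) ≠ 0 := by simpa using hv
  obtain ⟨μ, hμ, h⟩ := ρ.exists_measure_charFun_of_norm_eq_one ((‖v‖ : ℂ)⁻¹ • v)
    (by rw [norm_smul, norm_inv, Complex.norm_real, norm_norm, inv_mul_cancel₀ (by simpa using hv)])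
  refine ⟨(‖v‖₊ ^ 2) • μ, inferInstance, fun t => ?_⟩
  have := h t
  rw [map_smul, inner_smul_left, inner_smul_right] at this
  rw [charFun_apply_real] at this ⊢
  rw [integral_smul_nnreal_measure, this, NNReal.smul_def]
  simp
  field_simp

end AntiunitaryRep

/-! ### Density of trigonometric polynomials in `L²` -/

/-- An integrable real density with vanishing Fourier transform is zero: its positive and
negative parts define measures with the same characteristic function. -/
theorem ae_eq_zero_of_integral_exp_mul_real_eq_zero {μ : Measure ℝ} {a : ℝ → ℝ}
    (ha : Integrable a μ) (h : ∀ t : ℝ, ∫ p, Complex.exp (t * p * Complex.I) * a p ∂μ = 0) :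
    a =ᵐ[μ] 0 := by
  have hfin : ∀ b : ℝ → ℝ, Integrable b μ →
      IsFiniteMeasure (μ.withDensity fun p => ENNReal.ofReal (b p)) := fun b hb =>
    isFiniteMeasure_withDensity_ofReal hb.2
  have hchar : ∀ b : ℝ → ℝ, Integrable b μ → ∀ t,
      charFun (μ.withDensity fun p => ENNReal.ofReal (b p)) t =
        ∫ p, Complex.exp (t * p * Complex.I) * ((max (b p) 0 : ℝ) : ℂ) ∂μ := by
    intro b hb t
    rw [charFun_apply_real, integral_withDensity_eq_integral_toReal_smul₀
      hb.aestronglyMeasurable.aemeasurable.ennreal_ofReal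
      (ae_of_all _ fun _ => ENNReal.ofReal_lt_top)]
    congr 1
    funext p
    rw [ENNReal.toReal_ofReal', Complex.real_smul, mul_comm]
  have hi : ∀ b : ℝ → ℝ, Integrable b μ → ∀ t : ℝ,
      Integrable (fun p : ℝ => Complex.exp (t * p * Complex.I) * ((max (b p) 0 : ℝ) : ℂ)) μ := by
    intro b hb t
    refine hb.pos_part.ofReal.bdd_mul (c := 1) (by fun_prop) (ae_of_all _ fun p => ?_)
    rw [← Complex.ofReal_mul, Complex.norm_exp_ofReal_mul_I]
  have := hfin a ha
  have := hfin _ ha.neg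
  have heq : (μ.withDensity fun p => ENNReal.ofReal (a p)) =
      μ.withDensity fun p => ENNReal.ofReal ((-a) p) := by
    refine Measure.ext_of_charFun (funext fun t => ?_)
    rw [hchar a ha, hchar _ ha.neg, ← sub_eq_zero, ← integral_sub (hi a ha t) (hi _ ha.neg t),
      ← h t]
    congr 1
    funext p
    rw [← mul_sub, ← Complex.ofReal_sub]
    congr 2
    rcases le_total (a p) 0 with h0 | h0
    · simp [h0]
    · simp [h0]
  rw [withDensity_eq_iff ha.aestronglyMeasurable.aemeasurable.ennreal_ofReal
    ha.neg.aestronglyMeasurable.aemeasurable.ennreal_ofReal ha.lintegral_lt_top.ne] at heq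
  filter_upwards [heq] with p hp
  rcases le_total (a p) 0 with h0 | h0
  · rw [ENNReal.ofReal_of_nonpos h0, eq_comm, ENNReal.ofReal_eq_zero] at hp
    exact le_antisymm h0 (neg_nonpos.1 hp)
  · have h1 : (-a) p ≤ 0 := by simpa using h0
    rw [ENNReal.ofReal_of_nonpos h1, ENNReal.ofReal_eq_zero] at hp
    exact le_antisymm hp h0

theorem ae_eq_zero_of_integral_exp_mul_eq_zero {μ : Measure ℝ} {g : ℝ → ℂ}
    (hg : Integrable g μ) (h : ∀ t : ℝ, ∫ p, Complex.exp (t * p * Complex.I) * g p ∂μ = 0) :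
    g =ᵐ[μ] 0 := by
  have hi : ∀ k : ℝ → ℂ, Integrable k μ → ∀ t : ℝ,
      Integrable (fun p : ℝ => Complex.exp (t * p * Complex.I) * k p) μ := by
    intro k hk t
    refine hk.bdd_mul (c := 1) (by fun_prop) (ae_of_all _ fun p => ?_)
    rw [← Complex.ofReal_mul, Complex.norm_exp_ofReal_mul_I]
  have hcc : Integrable (fun p => conj (g p)) μ := by
    refine hg.mono (Complex.continuous_conj.comp_aestronglyMeasurable hg.1)
      (ae_of_all _ fun p => ?_)
    simp
  have hconj : ∀ t : ℝ, ∫ p, Complex.exp (t * p * Complex.I) * conj (g p) ∂μ = 0 := by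
    intro t
    have h1 := congrArg conj (h (-t))
    rw [← integral_conj, map_zero] at h1
    rw [← h1]
    congr 1
    funext p
    simp [← Complex.exp_conj]
  have hre : (fun p => (g p).re) =ᵐ[μ] 0 := by
    refine ae_eq_zero_of_integral_exp_mul_real_eq_zero hg.re fun t => ?_
    have h1 : ∀ p : ℝ, Complex.exp (t * p * Complex.I) * ((g p).re : ℂ) =
        (1 / 2) * (Complex.exp (t * p * Complex.I) * g p +
          Complex.exp (t * p * Complex.I) * conj (g p)) := fun p => by
      rw [← mul_add, Complex.add_conj]; push_cast; ring
    simp_rw [h1]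
    rw [integral_const_mul, integral_add (hi _ hg t) (hi _ hcc t), h, hconj]
    simp
  have him : (fun p => (g p).im) =ᵐ[μ] 0 := by
    refine ae_eq_zero_of_integral_exp_mul_real_eq_zero hg.im fun t => ?_
    have h1 : ∀ p : ℝ, Complex.exp (t * p * Complex.I) * ((g p).im : ℂ) =
        (-Complex.I / 2) * (Complex.exp (t * p * Complex.I) * g p -
          Complex.exp (t * p * Complex.I) * conj (g p)) := fun p => by
      rw [← mul_sub, Complex.sub_conj]; push_cast; ring_nf; simp
    simp_rw [h1]
    rw [integral_const_mul, integral_sub (hi _ hg t) (hi _ hcc t), h, hconj]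
    simp
  filter_upwards [hre, him] with p h1 h2
  exact Complex.ext h1 h2

/-- The character `p ↦ exp (itp)`. -/
noncomputable def expChar (t p : ℝ) : ℂ := Complex.exp (Complex.I * t * p)

theorem norm_expChar (t p : ℝ) : ‖expChar t p‖ = 1 := by
  rw [expChar, mul_assoc, mul_comm, ← Complex.ofReal_mul, Complex.norm_exp_ofReal_mul_I]

theorem continuous_expChar (t : ℝ) : Continuous (expChar t) := by
  unfold expChar; fun_prop

theorem measurable_expChar (t : ℝ) : Measurable (expChar t) := (continuous_expChar t).measurable

theorem memLp_expChar (μ : Measure ℝ) [IsFiniteMeasure μ] (t : ℝ) : MemLp (expChar t) 2 μ :=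
  MemLp.of_bound (continuous_expChar t).aestronglyMeasurable 1
    (ae_of_all _ fun p => (norm_expChar t p).le)

theorem conj_expChar (t p : ℝ) : conj (expChar t p) = expChar (-t) p := by
  simp [expChar, ← Complex.exp_conj]

theorem expChar_add (s t p : ℝ) : expChar (s + t) p = expChar s p * expChar t p := by
  simp only [expChar, ← Complex.exp_add]; congr 1; push_cast; ring

theorem charFun_eq_integral_expChar (μ : Measure ℝ) (t : ℝ) :
    charFun μ t = ∫ p, expChar t p ∂μ := by
  rw [charFun_apply_real]
  congr 1
  funext p
  rw [expChar]
  congr 1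
  ring

/-- The trigonometric polynomial `∑ c_t exp (itp)` with coefficients `c`. -/
noncomputable def trig : (ℝ →₀ ℂ) →ₗ[ℂ] (ℝ → ℂ) := Finsupp.linearCombination ℂ expChar

theorem trig_single (t : ℝ) (a : ℂ) : trig (Finsupp.single t a) = a • expChar t := by
  simp [trig]

theorem memLp_trig (μ : Measure ℝ) [IsFiniteMeasure μ] (c : ℝ →₀ ℂ) : MemLp (trig c) 2 μ := by
  induction c using Finsupp.induction_linear with
  | zero => simp
  | add f g hf hg => rw [map_add]; exact hf.add hg
  | single t a => rw [trig_single]; exact (memLp_expChar μ t).const_smul a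

theorem continuous_trig (c : ℝ →₀ ℂ) : Continuous (trig c) := by
  induction c using Finsupp.induction_linear with
  | zero => rw [map_zero]; exact continuous_const
  | add f g hf hg => rw [map_add]; exact hf.add hg
  | single t a => rw [trig_single]; exact (continuous_expChar t).const_smul a

/-- Trigonometric polynomials as elements of `L²`. -/
noncomputable def trigLp (μ : Measure ℝ) [IsFiniteMeasure μ] : (ℝ →₀ ℂ) →ₗ[ℂ] Lp ℂ 2 μ where
  toFun c := (memLp_trig μ c).toLp
  map_add' c d := by
    rw [← MemLp.toLp_add]
    exact MemLp.toLp_congr _ _ (by rw [map_add])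
  map_smul' a c := by
    rw [RingHom.id_apply, ← MemLp.toLp_const_smul]
    exact MemLp.toLp_congr _ _ (by rw [map_smul])

theorem denseRange_trigLp (μ : Measure ℝ) [IsFiniteMeasure μ] : DenseRange (trigLp μ) := by
  have h : (LinearMap.range (trigLp μ)).topologicalClosure = ⊤ := by
    rw [Submodule.topologicalClosure_eq_top_iff, Submodule.eq_bot_iff]
    intro g hg
    rw [Submodule.mem_orthogonal] at hg
    have hint : Integrable g μ := (Lp.memLp g).integrable (by norm_num)
    have h0 : (g : ℝ → ℂ) =ᵐ[μ] 0 := by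
      refine ae_eq_zero_of_integral_exp_mul_eq_zero hint fun t => ?_
      have h1 := hg _ ⟨Finsupp.single (-t) 1, rfl⟩
      rw [L2.inner_def] at h1
      rw [← h1]
      refine integral_congr_ae ?_
      filter_upwards [(memLp_trig μ (Finsupp.single (-t) 1)).coeFn_toLp] with p hp
      change _ = inner ℂ ((memLp_trig μ (Finsupp.single (-t) 1)).toLp _ p) _
      rw [hp, trig_single, one_smul, RCLike.inner_apply, conj_expChar, neg_neg, mul_comm, expChar]
      congr 2
      ring
    exact (Lp.eq_zero_iff_ae_eq_zero).2 h0
  have := congrArg (fun s : Submodule ℂ (Lp ℂ 2 μ) => (s : Set (Lp ℂ 2 μ))) h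
  simp only [Submodule.topologicalClosure_coe, Submodule.top_coe] at this
  rw [DenseRange, dense_iff_closure_eq]
  simpa [LinearMap.coe_range] using this

/-- Trigonometric polynomials are dense in `L²` of a finite measure. -/
theorem exists_trig_tendsto {μ : Measure ℝ} [IsFiniteMeasure μ] {f : ℝ → ℂ} (hf : MemLp f 2 μ) :
    ∃ c : ℕ → (ℝ →₀ ℂ), Tendsto (fun n => eLpNorm (trig (c n) - f) 2 μ) atTop (𝓝 0) := by
  have h := (denseRange_trigLp μ) hf.toLp
  rw [mem_closure_iff_seq_limit] at h
  obtain ⟨x, hx, hlim⟩ := h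
  choose c hc using hx
  refine ⟨c, ?_⟩
  rw [← funext hc] at hlim
  exact (Lp.tendsto_Lp_iff_tendsto_eLpNorm'' _ (fun n => memLp_trig μ (c n)) f hf).1 hlim

/-! ### The functional calculus -/

theorem exists_trig_tendsto_pair {μ ν : Measure ℝ} [IsFiniteMeasure μ] [IsFiniteMeasure ν]
    {f : ℝ → ℂ} (hμ : MemLp f 2 μ) (hν : MemLp f 2 ν) :
    ∃ c : ℕ → (ℝ →₀ ℂ), Tendsto (fun n => eLpNorm (trig (c n) - f) 2 μ) atTop (𝓝 0) ∧
      Tendsto (fun n => eLpNorm (trig (c n) - f) 2 ν) atTop (𝓝 0) := by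
  have hf : MemLp f 2 (μ + ν) := by
    have hm : AEStronglyMeasurable f (μ + ν) := hμ.1.add_measure hν.1
    rw [memLp_two_iff_integrable_sq_norm hm]
    exact ((memLp_two_iff_integrable_sq_norm hμ.1).1 hμ).add_measure
      ((memLp_two_iff_integrable_sq_norm hν.1).1 hν)
  obtain ⟨c, hc⟩ := exists_trig_tendsto hf
  exact ⟨c, tendsto_of_tendsto_of_tendsto_of_le_of_le tendsto_const_nhds hc (fun _ => zero_le)
      fun n => eLpNorm_mono_measure _ (Measure.le_add_right le_rfl),
    tendsto_of_tendsto_of_tendsto_of_le_of_le tendsto_const_nhds hc (fun _ => zero_le)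
      fun n => eLpNorm_mono_measure _ (Measure.le_add_left le_rfl)⟩

theorem trig_mapDomain_neg (c : ℝ →₀ ℂ) (p : ℝ) :
    trig ((c.mapRange conj (map_zero _)).mapDomain fun t => -t) p = conj (trig c p) := by
  induction c using Finsupp.induction_linear with
  | zero => simp
  | add f g hf hg =>
    rw [map_add, Finsupp.mapRange_add (by simp), Finsupp.mapDomain_add, map_add, Pi.add_apply,
      Pi.add_apply, hf, hg, map_add]
  | single t a =>
    rw [Finsupp.mapRange_single, Finsupp.mapDomain_single, trig_single, trig_single]
    simp [conj_expChar]

theorem trig_mapRange_conj (c : ℝ →₀ ℂ) (p : ℝ) :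
    trig (c.mapRange conj (map_zero _)) p = conj (trig c (-p)) := by
  induction c using Finsupp.induction_linear with
  | zero => simp
  | add f g hf hg =>
    rw [map_add, Finsupp.mapRange_add (by simp), map_add, Pi.add_apply,
      Pi.add_apply, hf, hg, map_add]
  | single t a =>
    rw [Finsupp.mapRange_single, trig_single, trig_single]
    simp only [Pi.smul_apply, smul_eq_mul, map_mul, conj_expChar]
    simp [expChar]

theorem eLpNorm_two_eq {μ : Measure ℝ} (f : ℝ → ℂ) :
    eLpNorm f 2 μ = (∫⁻ p, ‖f p‖ₑ ^ 2 ∂μ) ^ (1 / 2 : ℝ) := by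
  rw [eLpNorm_eq_lintegral_rpow_enorm_toReal two_ne_zero ENNReal.ofNat_ne_top]
  simp

namespace AntiunitaryRep

variable {H : Type*} [NormedAddCommGroup H] [InnerProductSpace ℂ H]
  (ρ : AntiunitaryRep H)

/-- The vector `∑ c_t U_t v` for finitely supported coefficients `c`. -/
noncomputable def trigU (v : H) : (ℝ →₀ ℂ) →ₗ[ℂ] H :=
  Finsupp.linearCombination ℂ fun t => ρ.U t v

theorem trigU_single (v : H) (t : ℝ) (a : ℂ) :
    ρ.trigU v (Finsupp.single t a) = a • ρ.U t v := by simp [trigU]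

theorem trigU_U (t : ℝ) (v : H) (c : ℝ →₀ ℂ) :
    ρ.trigU (ρ.U t v) c = ρ.U t (ρ.trigU v c) := by
  induction c using Finsupp.induction_linear with
  | zero => simp
  | add f g hf hg => simp only [map_add, hf, hg]
  | single s a => simp only [trigU_single, map_smul, U_U_comm]

theorem inner_trigU_left (c : ℝ →₀ ℂ) (v w : H) :
    inner ℂ w (ρ.trigU v c) =
      inner ℂ (ρ.trigU w ((c.mapRange conj (map_zero _)).mapDomain fun t => -t)) v := by
  induction c using Finsupp.induction_linear with
  | zero => simp
  | add f g hf hg =>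
    rw [map_add, inner_add_right, hf, hg, Finsupp.mapRange_add (by simp), Finsupp.mapDomain_add,
      map_add, inner_add_left]
  | single t a =>
    rw [Finsupp.mapRange_single, Finsupp.mapDomain_single, trigU_single, trigU_single,
      inner_smul_left, inner_smul_right, Complex.conj_conj]
    congr 1
    have := ρ.inner_U_U (-t) 0 w v
    rw [U_zero] at this
    rw [this]
    simp

theorem trigU_add_vec (c : ℝ →₀ ℂ) (v w : H) :
    ρ.trigU (v + w) c = ρ.trigU v c + ρ.trigU w c := by
  induction c using Finsupp.induction_linear with
  | zero => simp
  | add f g hf hg => rw [map_add, map_add, map_add, hf, hg]; abel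
  | single t a => simp only [trigU_single, map_add, smul_add]

theorem trigU_smul_vec (c : ℝ →₀ ℂ) (b : ℂ) (v : H) :
    ρ.trigU (b • v) c = b • ρ.trigU v c := by
  induction c using Finsupp.induction_linear with
  | zero => simp
  | add f g hf hg => rw [map_add, map_add, hf, hg, smul_add]
  | single t a => simp only [trigU_single, map_smul, smul_comm b a]

theorem inner_J_J (x y : H) : inner ℂ (ρ.J x) (ρ.J y) = inner ℂ y x := by
  have hre : ∀ x y : H, (inner ℂ (ρ.J x) (ρ.J y)).re = (inner ℂ x y).re := by
    intro x y
    have h1 := re_inner_eq_norm_add_mul_self_sub_norm_mul_self_sub_norm_mul_self_div_two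
      (𝕜 := ℂ) (ρ.J x) (ρ.J y)
    have h2 := re_inner_eq_norm_add_mul_self_sub_norm_mul_self_sub_norm_mul_self_div_two
      (𝕜 := ℂ) x y
    rw [← map_add, ρ.J.norm_map, ρ.J.norm_map, ρ.J.norm_map, ← h2] at h1
    exact h1
  rw [← inner_conj_symm y x]
  apply Complex.ext
  · rw [hre, Complex.conj_re]
  · have h := hre x (Complex.I • y)
    rw [map_smulₛₗ, inner_smul_right, inner_smul_right] at h
    simp at h
    rw [Complex.conj_im, h]

theorem J_trigU (c : ℝ →₀ ℂ) (v : H) :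
    ρ.J (ρ.trigU v c) = ρ.trigU (ρ.J v) (c.mapRange conj (map_zero _)) := by
  induction c using Finsupp.induction_linear with
  | zero => simp
  | add f g hf hg => simp only [map_add, hf, hg, Finsupp.mapRange_add (map_add conj)]
  | single t a => simp only [Finsupp.mapRange_single, trigU_single, map_smulₛₗ, ρ.J_U]

variable [CompleteSpace H]

/-- The finite measure on `ℝ` with characteristic function `t ↦ ⟨v, U_t v⟩`. -/
noncomputable def specMeasure (v : H) : Measure ℝ := (ρ.exists_measure_charFun v).choose

instance (v : H) : IsFiniteMeasure (ρ.specMeasure v) :=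
  (ρ.exists_measure_charFun v).choose_spec.1

theorem charFun_specMeasure (v : H) (t : ℝ) :
    charFun (ρ.specMeasure v) t = inner ℂ v (ρ.U t v) :=
  (ρ.exists_measure_charFun v).choose_spec.2 t

theorem eq_specMeasure {μ : Measure ℝ} [IsFiniteMeasure μ] {v : H}
    (h : ∀ t, charFun μ t = inner ℂ v (ρ.U t v)) : μ = ρ.specMeasure v :=
  Measure.ext_of_charFun (funext fun t => by rw [h, charFun_specMeasure])

theorem inner_trigU (v : H) (c d : ℝ →₀ ℂ) :
    inner ℂ (ρ.trigU v c) (ρ.trigU v d) =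
      inner ℂ (trigLp (ρ.specMeasure v) c) (trigLp (ρ.specMeasure v) d) := by
  induction c using Finsupp.induction_linear with
  | zero => simp
  | add f g hf hg => rw [map_add, map_add, inner_add_left, inner_add_left, hf, hg]
  | single s a =>
    induction d using Finsupp.induction_linear with
    | zero => simp
    | add f g hf hg => rw [map_add, map_add, inner_add_right, inner_add_right, hf, hg]
    | single t b =>
      rw [trigU_single, trigU_single, inner_smul_left, inner_smul_right, inner_U_U,
        ← charFun_specMeasure, charFun_eq_integral_expChar, L2.inner_def, ← integral_const_mul,
        ← integral_const_mul]
      refine integral_congr_ae ?_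
      filter_upwards [(memLp_trig (ρ.specMeasure v) (Finsupp.single s a)).coeFn_toLp,
        (memLp_trig (ρ.specMeasure v) (Finsupp.single t b)).coeFn_toLp] with p h1 h2
      change _ = inner ℂ ((memLp_trig (ρ.specMeasure v) (Finsupp.single s a)).toLp _ p)
        ((memLp_trig (ρ.specMeasure v) (Finsupp.single t b)).toLp _ p)
      rw [h1, h2, trig_single, trig_single, RCLike.inner_apply, sub_eq_add_neg, expChar_add,
        ← conj_expChar]
      simp only [Pi.smul_apply, smul_eq_mul, map_mul]
      ring

theorem norm_trigU (v : H) (c : ℝ →₀ ℂ) :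
    ‖ρ.trigU v c‖ = ‖trigLp (ρ.specMeasure v) c‖ := by
  rw [@norm_eq_sqrt_re_inner ℂ, @norm_eq_sqrt_re_inner ℂ, inner_trigU]

/-- The isometry of `L²(P^v)` onto the cyclic subspace of `v`, which maps `p ↦ exp (itp)` to
`U_t v`. -/
noncomputable def specIso (v : H) : Lp ℂ 2 (ρ.specMeasure v) →ₗᵢ[ℂ] H where
  toLinearMap := ((ρ.trigU v).extendOfNorm (trigLp (ρ.specMeasure v))).toLinearMap
  norm_map' := by
    have hd := denseRange_trigLp (ρ.specMeasure v)
    have hb : ∃ C : ℝ, ∀ x, ‖ρ.trigU v x‖ ≤ C * ‖trigLp (ρ.specMeasure v) x‖ :=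
      ⟨1, fun x => by rw [norm_trigU, one_mul]⟩
    intro x
    refine hd.induction_on (p := fun x =>
      ‖(ρ.trigU v).extendOfNorm (trigLp (ρ.specMeasure v)) x‖ = ‖x‖) x
      (isClosed_eq (by fun_prop) (by fun_prop)) fun c => ?_
    rw [LinearMap.extendOfNorm_eq hd hb, norm_trigU]

theorem specIso_trigLp (v : H) (c : ℝ →₀ ℂ) :
    ρ.specIso v (trigLp (ρ.specMeasure v) c) = ρ.trigU v c :=
  LinearMap.extendOfNorm_eq (denseRange_trigLp (ρ.specMeasure v))
    ⟨1, fun x => by rw [norm_trigU, one_mul]⟩ c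

open Classical in
/-- The functional calculus: the vector `f(A) v` for `f ∈ L²(P^v)` (and `0` otherwise), where
`A` is the generator with `U_t = exp (itA)`. -/
noncomputable def fc (f : ℝ → ℂ) (v : H) : H :=
  if h : MemLp f 2 (ρ.specMeasure v) then ρ.specIso v h.toLp else 0

variable {ρ} {f g : ℝ → ℂ} {v w : H}

theorem fc_of_memLp (h : MemLp f 2 (ρ.specMeasure v)) : ρ.fc f v = ρ.specIso v h.toLp :=
  dif_pos h

theorem inner_fc_fc (hf : MemLp f 2 (ρ.specMeasure v)) (hg : MemLp g 2 (ρ.specMeasure v)) :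
    inner ℂ (ρ.fc f v) (ρ.fc g v) = ∫ p, conj (f p) * g p ∂ρ.specMeasure v := by
  rw [fc_of_memLp hf, fc_of_memLp hg, LinearIsometry.inner_map_map, L2.inner_def]
  refine integral_congr_ae ?_
  filter_upwards [hf.coeFn_toLp, hg.coeFn_toLp] with p h1 h2
  rw [h1, h2, RCLike.inner_apply, mul_comm]

theorem norm_fc (hf : MemLp f 2 (ρ.specMeasure v)) :
    ‖ρ.fc f v‖ = (eLpNorm f 2 (ρ.specMeasure v)).toReal := by
  rw [fc_of_memLp hf, LinearIsometry.norm_map, Lp.norm_toLp]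

theorem fc_add (hf : MemLp f 2 (ρ.specMeasure v)) (hg : MemLp g 2 (ρ.specMeasure v)) :
    ρ.fc (f + g) v = ρ.fc f v + ρ.fc g v := by
  rw [fc_of_memLp hf, fc_of_memLp hg, fc_of_memLp (hf.add hg), MemLp.toLp_add, map_add]

theorem fc_sub (hf : MemLp f 2 (ρ.specMeasure v)) (hg : MemLp g 2 (ρ.specMeasure v)) :
    ρ.fc (f - g) v = ρ.fc f v - ρ.fc g v := by
  rw [fc_of_memLp hf, fc_of_memLp hg, fc_of_memLp (hf.sub hg), MemLp.toLp_sub, map_sub]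

theorem fc_smul (a : ℂ) (hf : MemLp f 2 (ρ.specMeasure v)) :
    ρ.fc (a • f) v = a • ρ.fc f v := by
  rw [fc_of_memLp hf, fc_of_memLp (hf.const_smul a), MemLp.toLp_const_smul, map_smul]

theorem fc_sum {ι : Type*} (s : Finset ι) {F : ι → ℝ → ℂ}
    (hF : ∀ i ∈ s, MemLp (F i) 2 (ρ.specMeasure v)) :
    ρ.fc (∑ i ∈ s, F i) v = ∑ i ∈ s, ρ.fc (F i) v := by
  classical
  induction s using Finset.induction_on with
  | empty =>
    have : ρ.fc (0 : ℝ → ℂ) v = 0 := by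
      have := fc_smul (ρ := ρ) (v := v) 0 (MemLp.zero (ε := ℂ))
      simpa using this
    simpa using this
  | insert i s hi ih =>
    rw [Finset.sum_insert hi, Finset.sum_insert hi,
      fc_add (hF i (by simp)) (memLp_finsetSum' s fun j hj => hF j (by simp [hj])),
      ih fun j hj => hF j (by simp [hj])]

theorem fc_trig (c : ℝ →₀ ℂ) (v : H) : ρ.fc (trig c) v = ρ.trigU v c := by
  rw [fc_of_memLp (memLp_trig _ c), ← specIso_trigLp]
  rfl

theorem fc_expChar (t : ℝ) (v : H) : ρ.fc (expChar t) v = ρ.U t v := by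
  have := fc_trig (ρ := ρ) (Finsupp.single t 1) v
  rwa [trig_single, trigU_single, one_smul, one_smul] at this

theorem fc_one (v : H) : ρ.fc (fun _ => 1) v = v := by
  have h : expChar 0 = fun _ => 1 := by funext p; simp [expChar]
  rw [← h, fc_expChar, U_zero]

theorem norm_fc_sub_fc (hf : MemLp f 2 (ρ.specMeasure v)) (hg : MemLp g 2 (ρ.specMeasure v)) :
    ‖ρ.fc f v - ρ.fc g v‖ = (eLpNorm (f - g) 2 (ρ.specMeasure v)).toReal := by
  rw [← fc_sub hf hg, norm_fc (hf.sub hg)]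

theorem tendsto_fc {ι : Type*} {l : Filter ι} {F : ι → ℝ → ℂ}
    (hF : ∀ᶠ i in l, MemLp (F i) 2 (ρ.specMeasure v)) (hf : MemLp f 2 (ρ.specMeasure v))
    (h : Tendsto (fun i => eLpNorm (F i - f) 2 (ρ.specMeasure v)) l (𝓝 0)) :
    Tendsto (fun i => ρ.fc (F i) v) l (𝓝 (ρ.fc f v)) := by
  rw [tendsto_iff_norm_sub_tendsto_zero]
  have h1 := (ENNReal.tendsto_toReal ENNReal.zero_ne_top).comp h
  refine h1.congr' ?_
  filter_upwards [hF] with i hi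
  rw [norm_fc_sub_fc hi hf]
  rfl

theorem tendsto_trigU {c : ℕ → (ℝ →₀ ℂ)} (hf : MemLp f 2 (ρ.specMeasure v))
    (h : Tendsto (fun n => eLpNorm (trig (c n) - f) 2 (ρ.specMeasure v)) atTop (𝓝 0)) :
    Tendsto (fun n => ρ.trigU v (c n)) atTop (𝓝 (ρ.fc f v)) := by
  simp_rw [← fc_trig]
  exact tendsto_fc (Eventually.of_forall fun n => memLp_trig _ _) hf h

/-- Dominated convergence for the functional calculus. -/
theorem tendsto_fc_of_dominated {ι : Type*} {l : Filter ι} [l.IsCountablyGenerated]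
    {F : ι → ℝ → ℂ} {b : ℝ → ℝ} (hb : MemLp b 2 (ρ.specMeasure v))
    (hFm : ∀ᶠ i in l, Measurable (F i)) (hfm : Measurable f)
    (hFb : ∀ᶠ i in l, ∀ p, ‖F i p‖ ≤ b p) (hfb : ∀ p, ‖f p‖ ≤ b p)
    (hlim : ∀ p, Tendsto (fun i => F i p) l (𝓝 (f p))) :
    Tendsto (fun i => ρ.fc (F i) v) l (𝓝 (ρ.fc f v)) := by
  have hmem : ∀ k : ℝ → ℂ, Measurable k → (∀ p, ‖k p‖ ≤ b p) → MemLp k 2 (ρ.specMeasure v) :=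
    fun k hk hkb => hb.mono' hk.aestronglyMeasurable (ae_of_all _ hkb)
  refine tendsto_fc ?_ (hmem f hfm hfb) ?_
  · filter_upwards [hFm, hFb] with i h1 h2 using hmem _ h1 h2
  · simp_rw [eLpNorm_two_eq]
    have h2b : MemLp (fun p => 2 * b p) 2 (ρ.specMeasure v) := hb.const_mul 2
    have hfin : ∫⁻ p, ‖2 * b p‖ₑ ^ 2 ∂ρ.specMeasure v ≠ ⊤ := by
      have := lintegral_rpow_enorm_lt_top_of_eLpNorm_lt_top two_ne_zero ENNReal.ofNat_ne_top h2b.2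
      simpa using this.ne
    have h0 : Tendsto (fun i => ∫⁻ p, ‖(F i - f) p‖ₑ ^ 2 ∂ρ.specMeasure v) l
        (𝓝 (∫⁻ _, 0 ∂ρ.specMeasure v)) := by
      refine tendsto_lintegral_filter_of_dominated_convergence (fun p => ‖2 * b p‖ₑ ^ 2)
        ?_ ?_ hfin (ae_of_all _ fun p => ?_)
      · filter_upwards [hFm] with i h1
        exact (h1.sub hfm).enorm.pow_const 2
      · filter_upwards [hFb] with i h1
        refine ae_of_all _ fun p => ?_
        gcongr
        rw [← ofReal_norm, ← ofReal_norm]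
        refine ENNReal.ofReal_le_ofReal ?_
        refine (norm_sub_le _ _).trans ?_
        rw [Real.norm_of_nonneg (by linarith [norm_nonneg (f p), hfb p])]
        linarith [h1 p, hfb p]
      · have h1 := ((hlim p).sub_const (f p)).enorm
        rw [sub_self, enorm_zero] at h1
        simpa using ENNReal.Tendsto.pow (n := 2) h1
    rw [lintegral_zero] at h0
    have h1 := h0.ennrpow_const (1 / 2 : ℝ)
    simpa using h1

end AntiunitaryRep

/-! ### Algebraic laws of the functional calculus -/

theorem memLp_mul_expChar {μ : Measure ℝ} {f : ℝ → ℂ} (hf : MemLp f 2 μ) (t : ℝ) :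
    MemLp (expChar t * f) 2 μ :=
  hf.of_le ((continuous_expChar t).aestronglyMeasurable.mul hf.1)
    (ae_of_all _ fun p => by simp [norm_expChar])

theorem memLp_conj {μ : Measure ℝ} {f : ℝ → ℂ} (hf : MemLp f 2 μ) :
    MemLp (fun p => conj (f p)) 2 μ :=
  hf.of_le (Complex.continuous_conj.comp_aestronglyMeasurable hf.1)
    (ae_of_all _ fun p => by simp)

namespace AntiunitaryRep

variable {H : Type*} [NormedAddCommGroup H] [InnerProductSpace ℂ H] [CompleteSpace H]
  {ρ : AntiunitaryRep H} {f g : ℝ → ℂ} {v w : H}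

theorem specMeasure_U (t : ℝ) (v : H) : ρ.specMeasure (ρ.U t v) = ρ.specMeasure v := by
  refine ρ.eq_specMeasure fun s => ?_
  rw [charFun_specMeasure, U_U_comm, LinearIsometryEquiv.inner_map_map]

theorem fc_U (f : ℝ → ℂ) (t : ℝ) (v : H) : ρ.fc f (ρ.U t v) = ρ.U t (ρ.fc f v) := by
  by_cases hf : MemLp f 2 (ρ.specMeasure v)
  · obtain ⟨c, hc⟩ := exists_trig_tendsto hf
    have h1 := tendsto_trigU hf hc
    rw [← specMeasure_U t v] at hf hc
    have h2 := tendsto_trigU hf hc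
    simp only [trigU_U] at h2
    exact tendsto_nhds_unique h2 (((ρ.U t).continuous.tendsto _).comp h1)
  · have hf' := hf
    rw [← specMeasure_U t v] at hf'
    rw [fc, fc, dif_neg hf, dif_neg hf', map_zero]

theorem U_fc (hf : MemLp f 2 (ρ.specMeasure v)) (t : ℝ) :
    ρ.U t (ρ.fc f v) = ρ.fc (expChar t * f) v := by
  obtain ⟨c, hc⟩ := exists_trig_tendsto hf
  have h1 := ((ρ.U t).continuous.tendsto _).comp (tendsto_trigU hf hc)
  refine tendsto_nhds_unique h1 ?_
  have h2 : ∀ d : ℝ →₀ ℂ, ρ.U t (ρ.trigU v d) = ρ.fc (expChar t * trig d) v := by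
    intro d
    induction d using Finsupp.induction_linear with
    | zero =>
      rw [map_zero, map_zero, map_zero, mul_zero]
      have := fc_sum (ρ := ρ) (v := v) (∅ : Finset ℕ) (F := fun _ => 0) (by simp)
      simpa using this.symm
    | add k l hk hl =>
      rw [map_add, map_add, map_add, hk, hl, mul_add,
        fc_add (memLp_mul_expChar (memLp_trig _ _) t) (memLp_mul_expChar (memLp_trig _ _) t)]
    | single s a =>
      rw [trigU_single, trig_single, map_smul, mul_smul_comm,
        fc_smul _ (memLp_mul_expChar (memLp_expChar _ _) t), ← ρ.U_add, ← fc_expChar]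
      congr 2
      funext p
      exact expChar_add t s p
  simp only [Function.comp_def, h2]
  refine tendsto_fc (Eventually.of_forall fun n => memLp_mul_expChar (memLp_trig _ _) t)
    (memLp_mul_expChar hf t) ?_
  refine hc.congr fun n => ?_
  rw [← mul_sub, eLpNorm_two_eq, eLpNorm_two_eq]
  congr 2
  funext p
  rw [Pi.mul_apply, enorm_mul, ← ofReal_norm (expChar t p), norm_expChar]
  simp

/-- The spectral measure of `f(A) v` has density `|f|²` with respect to that of `v`. -/
theorem specMeasure_fc (hfm : Measurable f) (hf : MemLp f 2 (ρ.specMeasure v)) :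
    ρ.specMeasure (ρ.fc f v) = (ρ.specMeasure v).withDensity fun p => ‖f p‖ₑ ^ 2 := by
  have hfin : IsFiniteMeasure ((ρ.specMeasure v).withDensity fun p => ‖f p‖ₑ ^ 2) := by
    refine isFiniteMeasure_withDensity ?_
    have := lintegral_rpow_enorm_lt_top_of_eLpNorm_lt_top two_ne_zero ENNReal.ofNat_ne_top hf.2
    simpa using this.ne
  refine (ρ.eq_specMeasure fun t => ?_).symm
  rw [U_fc hf, inner_fc_fc hf (memLp_mul_expChar hf t), charFun_eq_integral_expChar,
    integral_withDensity_eq_integral_toReal_smul (hfm.enorm.pow_const 2)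
      (ae_of_all _ fun p => by finiteness)]
  congr 1
  funext p
  rw [Pi.mul_apply, mul_left_comm, ENNReal.toReal_pow, toReal_enorm, Complex.real_smul,
    ← Complex.normSq_eq_conj_mul_self, Complex.normSq_eq_norm_sq]
  ring

theorem eLpNorm_specMeasure_fc (hfm : Measurable f) (hf : MemLp f 2 (ρ.specMeasure v))
    (hgm : Measurable g) :
    eLpNorm g 2 (ρ.specMeasure (ρ.fc f v)) = eLpNorm (g * f) 2 (ρ.specMeasure v) := by
  rw [eLpNorm_two_eq, eLpNorm_two_eq, specMeasure_fc hfm hf,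
    lintegral_withDensity_eq_lintegral_mul _ (hfm.enorm.pow_const 2) (hgm.enorm.pow_const 2)]
  congr 2
  funext p
  rw [Pi.mul_apply, Pi.mul_apply, enorm_mul, mul_pow, mul_comm]

theorem memLp_specMeasure_fc_iff (hfm : Measurable f) (hf : MemLp f 2 (ρ.specMeasure v))
    (hgm : Measurable g) :
    MemLp g 2 (ρ.specMeasure (ρ.fc f v)) ↔ MemLp (g * f) 2 (ρ.specMeasure v) := by
  rw [MemLp, MemLp, eLpNorm_specMeasure_fc hfm hf hgm]
  exact and_congr_left fun _ => iff_of_true hgm.aestronglyMeasurable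
    (hgm.mul hfm).aestronglyMeasurable

theorem memLp_trig_mul (hf : MemLp f 2 (ρ.specMeasure v)) (c : ℝ →₀ ℂ) :
    MemLp (trig c * f) 2 (ρ.specMeasure v) := by
  induction c using Finsupp.induction_linear with
  | zero => simp
  | add f g hf hg => rw [map_add, add_mul]; exact hf.add hg
  | single t a =>
    rw [trig_single, smul_mul_assoc]; exact (memLp_mul_expChar hf t).const_smul a

theorem trigU_fc (hf : MemLp f 2 (ρ.specMeasure v)) (c : ℝ →₀ ℂ) :
    ρ.trigU (ρ.fc f v) c = ρ.fc (trig c * f) v := by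
  induction c using Finsupp.induction_linear with
  | zero =>
    have := fc_sum (ρ := ρ) (v := v) (∅ : Finset ℕ) (F := fun _ => 0) (by simp)
    simpa using this.symm
  | add k l hk hl =>
    rw [map_add, map_add, hk, hl, add_mul, fc_add (memLp_trig_mul hf _) (memLp_trig_mul hf _)]
  | single t a =>
    rw [trigU_single, trig_single, smul_mul_assoc, fc_smul _ (memLp_mul_expChar hf t), U_fc hf]

/-- The functional calculus is multiplicative. -/
theorem fc_fc (hfm : Measurable f) (hgm : Measurable g) (hf : MemLp f 2 (ρ.specMeasure v))
    (hgf : MemLp (g * f) 2 (ρ.specMeasure v)) :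
    ρ.fc g (ρ.fc f v) = ρ.fc (g * f) v := by
  have hg := (memLp_specMeasure_fc_iff hfm hf hgm).2 hgf
  obtain ⟨c, hc⟩ := exists_trig_tendsto hg
  refine tendsto_nhds_unique (tendsto_trigU hg hc) ?_
  simp only [trigU_fc hf]
  refine tendsto_fc (Eventually.of_forall fun n => memLp_trig_mul hf _) hgf ?_
  refine hc.congr fun n => ?_
  rw [← sub_mul, eLpNorm_specMeasure_fc hfm hf ((continuous_trig _).measurable.sub hgm)]

/-- The adjoint of `f(A)` is given by the conjugate function. -/
theorem inner_fc_right (hv : MemLp f 2 (ρ.specMeasure v)) (hw : MemLp f 2 (ρ.specMeasure w)) :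
    inner ℂ w (ρ.fc f v) = inner ℂ (ρ.fc (fun p => conj (f p)) w) v := by
  obtain ⟨c, hcv, hcw⟩ := exists_trig_tendsto_pair hv hw
  have h1 := (tendsto_const_nhds (x := w)).inner (𝕜 := ℂ) (tendsto_trigU hv hcv)
  refine tendsto_nhds_unique h1 ?_
  simp only [inner_trigU_left]
  have h2 : Tendsto (fun n => ρ.trigU w (((c n).mapRange conj (map_zero _)).mapDomain fun t => -t))
      atTop (𝓝 (ρ.fc (fun p => conj (f p)) w)) := by
    refine tendsto_trigU (memLp_conj hw) (hcw.congr fun n => ?_)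
    rw [eLpNorm_two_eq, eLpNorm_two_eq]
    congr 2
    funext p
    rw [Pi.sub_apply, Pi.sub_apply, trig_mapDomain_neg, ← map_sub, ← ofReal_norm, ← ofReal_norm,
      RCLike.norm_conj]
  exact h2.inner tendsto_const_nhds

theorem fc_smul_vec (b : ℂ) (hv : MemLp f 2 (ρ.specMeasure v))
    (hb : MemLp f 2 (ρ.specMeasure (b • v))) :
    ρ.fc f (b • v) = b • ρ.fc f v := by
  obtain ⟨c, hcv, hcb⟩ := exists_trig_tendsto_pair hv hb
  have h1 := tendsto_trigU hb hcb
  simp only [trigU_smul_vec] at h1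
  exact tendsto_nhds_unique h1 ((tendsto_trigU hv hcv).const_smul b)

/-- Additivity in the vector, for bounded functions. -/
theorem fc_add_vec (hfm : Measurable f) {C : ℝ} (hC : ∀ p, ‖f p‖ ≤ C) (v w : H) :
    ρ.fc f (v + w) = ρ.fc f v + ρ.fc f w := by
  have hf : ∀ (μ : Measure ℝ) [IsFiniteMeasure μ], MemLp f 2 μ := fun μ _ =>
    MemLp.of_bound hfm.aestronglyMeasurable C (ae_of_all _ hC)
  obtain ⟨c, h1, h2⟩ := exists_trig_tendsto_pair
    (hf (ρ.specMeasure v + ρ.specMeasure w)) (hf (ρ.specMeasure (v + w)))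
  have h3 := tendsto_trigU (hf _) h2
  simp only [trigU_add_vec] at h3
  refine tendsto_nhds_unique h3 ((tendsto_trigU (hf _) ?_).add (tendsto_trigU (hf _) ?_))
  · exact tendsto_of_tendsto_of_tendsto_of_le_of_le tendsto_const_nhds h1 (fun _ => zero_le)
      fun n => eLpNorm_mono_measure _ (Measure.le_add_right le_rfl)
  · exact tendsto_of_tendsto_of_tendsto_of_le_of_le tendsto_const_nhds h1 (fun _ => zero_le)
      fun n => eLpNorm_mono_measure _ (Measure.le_add_left le_rfl)

theorem specMeasure_J (v : H) : ρ.specMeasure (ρ.J v) = (ρ.specMeasure v).map (fun p => -p) := by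
  have : IsFiniteMeasure ((ρ.specMeasure v).map (fun p => -p)) := Measure.isFiniteMeasure_map _ _
  refine (ρ.eq_specMeasure fun t => ?_).symm
  rw [← ρ.J_U, inner_J_J, charFun_eq_integral_expChar, integral_map (by fun_prop)
    (continuous_expChar t).aestronglyMeasurable, ← inner_conj_symm, ← charFun_specMeasure,
    charFun_eq_integral_expChar, ← integral_conj]
  congr 1
  funext p
  rw [conj_expChar]
  simp [expChar]

theorem eLpNorm_specMeasure_J (hf : Measurable f) (v : H) :
    eLpNorm f 2 (ρ.specMeasure (ρ.J v)) =
      eLpNorm (fun p => conj (f (-p))) 2 (ρ.specMeasure v) := by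
  rw [specMeasure_J, eLpNorm_map_measure hf.aestronglyMeasurable (by fun_prop), eLpNorm_two_eq,
    eLpNorm_two_eq]
  congr 2
  funext p
  rw [← ofReal_norm, ← ofReal_norm, RCLike.norm_conj]
  rfl

/-- `J f(A) v = f̃(A) J v` with `f̃(p) = conj (f (-p))`, since `J A J = -A`. -/
theorem J_fc (hfm : Measurable f) (hf : MemLp f 2 (ρ.specMeasure v)) :
    ρ.J (ρ.fc f v) = ρ.fc (fun p => conj (f (-p))) (ρ.J v) := by
  obtain ⟨c, hc⟩ := exists_trig_tendsto hf
  have h1 := (ρ.J.continuous.tendsto _).comp (tendsto_trigU hf hc)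
  refine tendsto_nhds_unique h1 ?_
  simp only [Function.comp_def, J_trigU]
  have hm : Measurable fun p => conj (f (-p)) :=
    Complex.continuous_conj.measurable.comp (hfm.comp measurable_neg)
  refine tendsto_trigU ⟨hm.aestronglyMeasurable, ?_⟩ (hc.congr fun n => ?_)
  · rw [eLpNorm_specMeasure_J hm]
    simpa using hf.2
  · rw [eLpNorm_specMeasure_J ((continuous_trig _).measurable.sub hm)]
    congr 1
    funext p
    simp [trig_mapRange_conj]

end AntiunitaryRep

/-! ### The spectral measure of the one-parameter group -/

/-- The complex indicator function of a set. -/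
noncomputable def ind (E : Set ℝ) : ℝ → ℂ := E.indicator fun _ => 1

theorem measurable_ind {E : Set ℝ} (hE : MeasurableSet E) : Measurable (ind E) :=
  measurable_const.indicator hE

theorem norm_ind_le (E : Set ℝ) (p : ℝ) : ‖ind E p‖ ≤ 1 := by
  by_cases h : p ∈ E <;> simp [ind, h]

theorem conj_ind (E : Set ℝ) (p : ℝ) : conj (ind E p) = ind E p := by
  by_cases h : p ∈ E <;> simp [ind, h]

theorem ind_mul_ind (E : Set ℝ) : ind E * ind E = ind E := by
  funext p
  by_cases h : p ∈ E <;> simp [ind, h]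

theorem memLp_ind {E : Set ℝ} (hE : MeasurableSet E) (μ : Measure ℝ) [IsFiniteMeasure μ] :
    MemLp (ind E) 2 μ :=
  MemLp.of_bound (measurable_ind hE).aestronglyMeasurable 1 (ae_of_all _ (norm_ind_le E))

theorem integral_ind {E : Set ℝ} (hE : MeasurableSet E) (μ : Measure ℝ) :
    ∫ p, ind E p ∂μ = μ.real E := by
  rw [ind, integral_indicator_const _ hE]
  simp

theorem simpleFunc_eq_sum_ind (s : SimpleFunc ℝ ℂ) :
    (s : ℝ → ℂ) = ∑ y ∈ s.range, y • ind (s ⁻¹' {y}) := by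
  classical
  funext p
  rw [Finset.sum_apply, Finset.sum_eq_single (s p)]
  · simp [ind]
  · intro y _ hy
    have : p ∉ s ⁻¹' {y} := fun h => hy (by simpa using h.symm)
    simp [ind, this]
  · intro h
    exact absurd (s.mem_range_self p) h

namespace SpectralMeasure

variable {H : Type*} [NormedAddCommGroup H] [InnerProductSpace ℂ H] [CompleteSpace H]
  (P : SpectralMeasure H)

instance (v : H) : IsFiniteMeasure (P.measure v) :=
  ⟨by rw [P.measure_apply v MeasurableSet.univ]; exact ENNReal.ofReal_lt_top⟩

theorem inner_proj_self (v : H) {E : Set ℝ} (hE : MeasurableSet E) :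
    inner ℂ v (P.proj E v) = ((P.measure v).real E : ℂ) := by
  have hs := (P.isStarProjection E).isSelfAdjoint.isSymmetric
  have him : (inner ℂ v (P.proj E v)).im = 0 := by
    have h := hs v v
    simp only [ContinuousLinearMap.coe_coe] at h
    rw [← Complex.conj_eq_iff_im, inner_conj_symm, h]
  rw [Measure.real, P.measure_apply v hE, ENNReal.toReal_ofReal (P.re_inner_proj_nonneg E v)]
  apply Complex.ext <;> simp [him]

theorem inner_simpleIntegral (s : SimpleFunc ℝ ℂ) (v : H) :
    inner ℂ v (P.simpleIntegral s v) = ∫ p, s p ∂P.measure v := by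
  rw [SimpleFunc.integral_eq_sum _ (s.integrable_of_isFiniteMeasure), simpleIntegral, inner_sum]
  refine Finset.sum_congr rfl fun y _ => ?_
  rw [inner_smul_right, inner_proj_self _ _ (s.measurableSet_preimage _), Complex.real_smul,
    mul_comm]

theorem IsIntegral.inner_eq {P : SpectralMeasure H} {f : ℝ → ℂ} {v w : H}
    (hf : MemLp f 2 (P.measure v)) (h : P.IsIntegral f v w) :
    inner ℂ v w = ∫ p, f p ∂P.measure v := by
  obtain ⟨s, hs, hw⟩ := h
  have h1 := (tendsto_const_nhds (x := v)).inner (𝕜 := ℂ) hw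
  simp only [inner_simpleIntegral] at h1
  refine tendsto_nhds_unique h1 ?_
  refine tendsto_integral_of_L1' f hf.1
    (Eventually.of_forall fun n => (s n).integrable_of_isFiniteMeasure) ?_
  have h2 := ENNReal.Tendsto.mul_const (b := P.measure v univ ^ (1 / (1 : ENNReal).toReal -
    1 / (2 : ENNReal).toReal)) hs (Or.inr (by
      refine ENNReal.rpow_ne_top_of_nonneg (by norm_num) (measure_ne_top _ _)))
  rw [zero_mul] at h2
  refine tendsto_of_tendsto_of_tendsto_of_le_of_le tendsto_const_nhds h2 (fun _ => zero_le)
    fun n => ?_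
  exact eLpNorm_le_eLpNorm_mul_rpow_measure_univ (by norm_num)
    ((s n).aestronglyMeasurable.sub hf.1)

theorem ext_proj {P Q : SpectralMeasure H} (h : P.proj = Q.proj) : P = Q := by
  cases P; cases Q; cases h; rfl

theorem measure_eq_specMeasure {P : SpectralMeasure H} {ρ : AntiunitaryRep H}
    (h : P.Represents ρ) (v : H) : P.measure v = ρ.specMeasure v := by
  refine ρ.eq_specMeasure fun t => ?_
  rw [(h t v).inner_eq (memLp_expChar _ t), charFun_eq_integral_expChar]

/-- A spectral measure is determined by the one-parameter group which it represents. -/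
theorem Represents.eq {P Q : SpectralMeasure H} {ρ : AntiunitaryRep H}
    (hP : P.Represents ρ) (hQ : Q.Represents ρ) : P = Q := by
  refine ext_proj (funext fun E => ?_)
  by_cases hE : MeasurableSet E
  · have : (P.proj E : H →ₗ[ℂ] H) = Q.proj E := by
      rw [← ext_inner_map]
      intro v
      have h1 := P.inner_proj_self v hE
      have h2 := Q.inner_proj_self v hE
      rw [measure_eq_specMeasure hP] at h1
      rw [measure_eq_specMeasure hQ, ← h1] at h2
      rw [← inner_conj_symm, ← inner_conj_symm ((Q.proj E : H →ₗ[ℂ] H) v)]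
      exact congrArg conj h2.symm
    exact ContinuousLinearMap.coe_injective this
  · rw [P.proj_not_measurable E hE, Q.proj_not_measurable E hE]

end SpectralMeasure

namespace AntiunitaryRep

variable {H : Type*} [NormedAddCommGroup H] [InnerProductSpace ℂ H] [CompleteSpace H]
  (ρ : AntiunitaryRep H)

theorem norm_fc_le {f : ℝ → ℂ} (hfm : Measurable f) (hf : ∀ p, ‖f p‖ ≤ 1) (v : H) :
    ‖ρ.fc f v‖ ≤ ‖v‖ := by
  have h1 : MemLp f 2 (ρ.specMeasure v) :=
    MemLp.of_bound hfm.aestronglyMeasurable 1 (ae_of_all _ hf)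
  have h2 : MemLp (fun _ : ℝ => (1 : ℂ)) 2 (ρ.specMeasure v) := memLp_const 1
  conv_rhs => rw [← fc_one (ρ := ρ) v]
  rw [norm_fc h1, norm_fc h2]
  refine ENNReal.toReal_mono h2.2.ne (eLpNorm_mono fun p => ?_)
  simpa using hf p

open Classical in
/-- The spectral projection `1_E(A)`. -/
noncomputable def specProj (E : Set ℝ) : H →L[ℂ] H :=
  if hE : MeasurableSet E then
    LinearMap.mkContinuous
      { toFun := ρ.fc (ind E)
        map_add' := fc_add_vec (measurable_ind hE) (norm_ind_le E)
        map_smul' := fun b v => fc_smul_vec b (memLp_ind hE _) (memLp_ind hE _) } 1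
      fun v => by
        rw [one_mul]
        exact ρ.norm_fc_le (measurable_ind hE) (norm_ind_le E) v
  else 0

variable {ρ}

theorem specProj_apply {E : Set ℝ} (hE : MeasurableSet E) (v : H) :
    ρ.specProj E v = ρ.fc (ind E) v := by
  rw [specProj, dif_pos hE]
  rfl

theorem isStarProjection_specProj (E : Set ℝ) : IsStarProjection (ρ.specProj E) := by
  by_cases hE : MeasurableSet E
  · constructor
    · ext v
      change ρ.specProj E (ρ.specProj E v) = _
      rw [specProj_apply hE, specProj_apply hE, fc_fc (measurable_ind hE) (measurable_ind hE)
        (memLp_ind hE _) (by rw [ind_mul_ind]; exact memLp_ind hE _), ind_mul_ind]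
    · rw [ContinuousLinearMap.isSelfAdjoint_iff_isSymmetric]
      intro v w
      simp only [ContinuousLinearMap.coe_coe]
      rw [specProj_apply hE, specProj_apply hE, inner_fc_right (memLp_ind hE _) (memLp_ind hE _)]
      simp only [conj_ind]
  · rw [specProj, dif_neg hE]
    exact IsStarProjection.zero _

theorem hasSum_specProj (E : ℕ → Set ℝ) (hE : ∀ i, MeasurableSet (E i))
    (hd : Pairwise (Function.onFun Disjoint E)) (v : H) :
    HasSum (fun i => ρ.specProj (E i) v) (ρ.specProj (⋃ i, E i) v) := by
  have hU := MeasurableSet.iUnion hE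
  simp only [specProj_apply (hE _), specProj_apply hU, HasSum, SummationFilter.unconditional_filter]
  have hsum : ∀ s : Finset ℕ, ∑ i ∈ s, ρ.fc (ind (E i)) v = ρ.fc (∑ i ∈ s, ind (E i)) v :=
    fun s => (fc_sum s fun i _ => memLp_ind (hE i) _).symm
  have hs : ∀ s : Finset ℕ, ∑ i ∈ s, ind (E i) = ind (⋃ i ∈ s, E i) := fun s => by
    funext p
    rw [Finset.sum_apply]
    have := Finset.indicator_biUnion_apply s E (f := fun _ => (1 : ℂ))
      (fun i _ j _ hij => hd hij) p
    rw [ind, this]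
    rfl
  simp only [hsum, hs]
  refine tendsto_fc_of_dominated (b := fun _ => 1) (memLp_const 1)
    (Eventually.of_forall fun s => measurable_ind (Finset.measurableSet_biUnion s fun i _ => hE i))
    (measurable_ind hU) (Eventually.of_forall fun s => norm_ind_le _) (norm_ind_le _) fun p => ?_
  by_cases hp : p ∈ ⋃ i, E i
  · obtain ⟨i, hi⟩ := mem_iUnion.1 hp
    refine tendsto_const_nhds.congr' ?_
    filter_upwards [eventually_ge_atTop {i}] with s hs
    have : p ∈ ⋃ i ∈ s, E i := mem_biUnion (hs (Finset.mem_singleton_self i)) hi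
    simp only [ind, indicator_of_mem this, indicator_of_mem hp]
  · refine tendsto_const_nhds.congr fun s => ?_
    have : p ∉ ⋃ i ∈ s, E i := fun h => hp (iUnion₂_subset_iUnion _ _ h)
    simp only [ind, indicator_of_notMem this, indicator_of_notMem hp]

variable (ρ) in
/-- The spectral measure of the one-parameter group. -/
noncomputable def spectral : SpectralMeasure H where
  proj := ρ.specProj
  isStarProjection := isStarProjection_specProj
  proj_univ := by
    ext v
    rw [specProj_apply MeasurableSet.univ]
    have : ind univ = fun _ => 1 := by simp [ind]
    rw [this, fc_one]
    rfl
  proj_not_measurable E hE := by rw [specProj, dif_neg hE]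
  hasSum_proj E hE hd v := hasSum_specProj E hE hd v

theorem measure_spectral (v : H) : ρ.spectral.measure v = ρ.specMeasure v := by
  ext E hE
  have h1 : MemLp (fun _ : ℝ => (1 : ℂ)) 2 (ρ.specMeasure v) := memLp_const 1
  have h : inner ℂ v (ρ.fc (ind E) v) = ((ρ.specMeasure v).real E : ℂ) := by
    have := inner_fc_fc h1 (memLp_ind hE (ρ.specMeasure v))
    rw [fc_one] at this
    rw [this]
    simp [integral_ind hE]
  rw [SpectralMeasure.measure_apply _ _ hE]
  change ENNReal.ofReal (inner ℂ v (ρ.specProj E v)).re = _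
  rw [specProj_apply hE, h, Complex.ofReal_re, Measure.real,
    ENNReal.ofReal_toReal (measure_ne_top _ _)]

theorem simpleIntegral_spectral (s : SimpleFunc ℝ ℂ) (v : H) :
    ρ.spectral.simpleIntegral s v = ρ.fc s v := by
  conv_rhs => rw [simpleFunc_eq_sum_ind s]
  rw [fc_sum _ fun y _ => (memLp_ind (s.measurableSet_preimage _) _).const_smul y]
  refine Finset.sum_congr rfl fun y _ => ?_
  rw [fc_smul _ (memLp_ind (s.measurableSet_preimage _) _)]
  congr 1
  exact specProj_apply (s.measurableSet_preimage _) v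

theorem isIntegral_spectral_iff {f : ℝ → ℂ} {v w : H} (hf : MemLp f 2 (ρ.specMeasure v)) :
    ρ.spectral.IsIntegral f v w ↔ w = ρ.fc f v := by
  have key : ∀ s : ℕ → SimpleFunc ℝ ℂ,
      Tendsto (fun n => eLpNorm (fun p => s n p - f p) 2 (ρ.specMeasure v)) atTop (𝓝 0) →
      Tendsto (fun n => ρ.spectral.simpleIntegral (s n) v) atTop (𝓝 (ρ.fc f v)) := by
    intro s hs
    simp only [simpleIntegral_spectral]
    exact tendsto_fc (Eventually.of_forall fun n => (s n).memLp_of_isFiniteMeasure 2 _) hf hs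
  rw [SpectralMeasure.IsIntegral, measure_spectral]
  constructor
  · rintro ⟨s, hs, hw⟩
    exact tendsto_nhds_unique hw (key s hs)
  · rintro rfl
    have hex : ∀ n : ℕ, ∃ g : SimpleFunc ℝ ℂ,
        eLpNorm (f - (g : ℝ → ℂ)) 2 (ρ.specMeasure v) < ((n : ENNReal) + 1)⁻¹ ∧
          MemLp g 2 (ρ.specMeasure v) := fun n =>
      hf.exists_simpleFunc_eLpNorm_sub_lt (by norm_num) (by simp)
    choose s hs _ using hex
    have hs0 : Tendsto (fun n => eLpNorm (fun p => s n p - f p) 2 (ρ.specMeasure v))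
        atTop (𝓝 0) := by
      have h0 : Tendsto (fun n : ℕ => ((n : ENNReal) + 1)⁻¹) atTop (𝓝 0) := by
        have := (tendsto_add_atTop_iff_nat 1).2 ENNReal.tendsto_inv_nat_nhds_zero
        simpa using this
      refine tendsto_of_tendsto_of_tendsto_of_le_of_le tendsto_const_nhds h0
        (fun _ => zero_le) fun n => ?_
      have := eLpNorm_sub_comm f (s n) 2 (ρ.specMeasure v)
      exact this.symm.le.trans (hs n).le
    exact ⟨s, hs0, key s hs0⟩

theorem spectral_represents : ρ.spectral.Represents ρ := fun t v =>
  (isIntegral_spectral_iff (memLp_expChar _ t)).2 (fc_expChar t v).symm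

theorem integral_spectral {f : ℝ → ℂ} {v : H} (hf : MemLp f 2 (ρ.specMeasure v)) :
    ρ.spectral.integral f v = ρ.fc f v := by
  have h : ρ.spectral.MemDomain f v ∧ ∃ w, ρ.spectral.IsIntegral f v w :=
    ⟨by rwa [SpectralMeasure.MemDomain, measure_spectral],
      ρ.fc f v, (isIntegral_spectral_iff hf).2 rfl⟩
  rw [SpectralMeasure.integral, dif_pos h]
  exact (isIntegral_spectral_iff hf).1 h.2.choose_spec

end AntiunitaryRep

/-! ### Smooth vectors -/

/-- The symbol `p ↦ (ip)ⁿ` of the `n`-th derivative. -/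
noncomputable def mon (n : ℕ) (p : ℝ) : ℂ := (Complex.I * p) ^ n

/-- The symbol `p ↦ (1 + ip)ⁿ` of the differential operator `(1 + d/dt)ⁿ`. -/
noncomputable def wt (n : ℕ) (p : ℝ) : ℂ := (1 + Complex.I * p) ^ n

theorem continuous_mon (n : ℕ) : Continuous (mon n) := by unfold mon; fun_prop

theorem continuous_wt (n : ℕ) : Continuous (wt n) := by unfold wt; fun_prop

theorem norm_mon (n : ℕ) (p : ℝ) : ‖mon n p‖ = |p| ^ n := by simp [mon]

theorem sq_norm_one_add_I_mul (p : ℝ) : ‖1 + Complex.I * p‖ ^ 2 = 1 + p ^ 2 := by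
  rw [← Complex.normSq_eq_norm_sq, Complex.normSq_apply]
  simp
  ring

theorem one_le_norm_one_add_I_mul (p : ℝ) : 1 ≤ ‖1 + Complex.I * p‖ := by
  nlinarith [sq_norm_one_add_I_mul p, norm_nonneg (1 + Complex.I * p), sq_nonneg p]

theorem abs_le_norm_one_add_I_mul (p : ℝ) : |p| ≤ ‖1 + Complex.I * p‖ := by
  refine abs_le_of_sq_le_sq ?_ (norm_nonneg _)
  rw [sq_norm_one_add_I_mul]; linarith

theorem one_le_norm_wt (n : ℕ) (p : ℝ) : 1 ≤ ‖wt n p‖ := by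
  rw [wt, norm_pow]; exact one_le_pow₀ (one_le_norm_one_add_I_mul p)

theorem wt_ne_zero (n : ℕ) (p : ℝ) : wt n p ≠ 0 := by
  intro h
  have := one_le_norm_wt n p
  rw [h, norm_zero] at this
  linarith

theorem norm_mon_le_norm_wt {k n : ℕ} (h : k ≤ n) (p : ℝ) : ‖mon k p‖ ≤ ‖wt n p‖ := by
  rw [norm_mon, wt, norm_pow]
  exact (pow_le_pow_left₀ (abs_nonneg p) (abs_le_norm_one_add_I_mul p) k).trans
    (pow_le_pow_right₀ (one_le_norm_one_add_I_mul p) h)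

theorem conj_wt_neg (n : ℕ) (p : ℝ) : conj (wt n (-p)) = wt n p := by simp [wt]

theorem wt_eq_sum (n : ℕ) :
    wt n = ∑ k ∈ Finset.range (n + 1), (n.choose k : ℂ) • mon k := by
  funext p
  rw [wt, add_comm, add_pow, Finset.sum_apply]
  refine Finset.sum_congr rfl fun k _ => ?_
  simp [mon, mul_comm]

theorem norm_expChar_sub_le (s t p : ℝ) : ‖expChar s p - expChar t p‖ ≤ |s - t| * |p| := by
  have h : expChar s p - expChar t p =
      expChar t p * (Complex.exp (Complex.I * ((s - t) * p : ℝ)) - 1) := by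
    rw [mul_sub, mul_one, expChar, expChar, ← Complex.exp_add]
    congr 2
    push_cast
    ring
  rw [h, norm_mul, norm_expChar, one_mul]
  refine Real.norm_exp_I_mul_ofReal_sub_one_le.trans ?_
  rw [norm_mul, Real.norm_eq_abs, Real.norm_eq_abs]

theorem hasDerivAt_expChar (p t : ℝ) :
    HasDerivAt (fun s => expChar s p) (mon 1 p * expChar t p) t := by
  have h : HasDerivAt (fun s : ℝ => Complex.I * (s : ℂ) * p) (Complex.I * 1 * p) t :=
    ((Complex.ofRealCLM.hasDerivAt (x := t)).const_mul Complex.I).mul_const (p : ℂ)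
  have h2 := h.cexp
  unfold expChar
  convert h2 using 1
  simp [mon, mul_comm]

theorem mon_succ (n : ℕ) : mon (n + 1) = mon 1 * mon n := by
  funext p
  simp only [mon, Pi.mul_apply]
  ring

namespace AntiunitaryRep

variable {H : Type*} [NormedAddCommGroup H] [InnerProductSpace ℂ H] {ρ : AntiunitaryRep H}

variable (ρ) in
/-- The operator `(1 + d/dt)ⁿ = (1 + iA)ⁿ` on smooth vectors. -/
noncomputable def wtOp (n : ℕ) : ρ.SmoothVectors →ₗ[ℂ] H :=
  ∑ k ∈ Finset.range (n + 1), (n.choose k : ℂ) • ρ.orbitDeriv k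

theorem continuous_wtOp (n : ℕ) : Continuous (ρ.wtOp n) := by
  have h : ∀ k, Continuous (ρ.orbitDeriv k) := fun k =>
    ρ.withSeminorms_smoothSeminorm.continuous_normedSpace_rng H (ρ.orbitDeriv k)
      ⟨{k}, 1, fun φ => by simp; exact le_rfl⟩
  have : (ρ.wtOp n : ρ.SmoothVectors → H) =
      fun φ => ∑ k ∈ Finset.range (n + 1), (n.choose k : ℂ) • ρ.orbitDeriv k φ := by
    funext φ
    simp [wtOp]
  rw [this]
  exact continuous_finsetSum _ fun k _ => (h k).const_smul _

variable (ρ) in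
/-- The distribution vector `φ ↦ ⟨(1 + iA)ⁿ φ, x⟩`, that is, `(1 - iA)ⁿ x`. -/
noncomputable def wtDist (n : ℕ) (x : H) : ρ.DistVectors :=
  show ρ.SmoothVectors →L⋆[ℂ] ℂ from
  { toFun := fun φ => inner ℂ (ρ.wtOp n φ) x
    map_add' := fun φ ψ => by rw [map_add, inner_add_left]
    map_smul' := fun c φ => by rw [map_smul, inner_smul_left, smul_eq_mul]
    cont := (continuous_wtOp n).inner continuous_const }

variable [CompleteSpace H]

/-- The orbit map of a vector in the domain of `A` is differentiable. -/
theorem hasDerivAt_fc_expChar {g : ℝ → ℂ} {v : H} (hgm : Measurable g)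
    (hg : MemLp g 2 (ρ.specMeasure v)) (hg1 : MemLp (mon 1 * g) 2 (ρ.specMeasure v)) (t : ℝ) :
    HasDerivAt (fun s => ρ.fc (expChar s * g) v) (ρ.fc (expChar t * (mon 1 * g)) v) t := by
  rw [hasDerivAt_iff_tendsto_slope]
  have hs : ∀ s, slope (fun s => ρ.fc (expChar s * g) v) t s =
      ρ.fc (((s - t : ℝ) : ℂ)⁻¹ • (expChar s * g - expChar t * g)) v := by
    intro s
    rw [fc_smul _ ((memLp_mul_expChar hg s).sub (memLp_mul_expChar hg t)),
      fc_sub (memLp_mul_expChar hg s) (memLp_mul_expChar hg t), slope_def_module,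
      ← Complex.ofReal_inv, Complex.coe_smul]
  rw [funext hs]
  refine tendsto_fc_of_dominated (b := fun p => ‖(mon 1 * g) p‖) hg1.norm
    (Eventually.of_forall fun s => ?_) ?_ ?_ (fun p => ?_) fun p => ?_
  · have h1 := measurable_expChar s
    have h2 := measurable_expChar t
    fun_prop
  · have h1 := (continuous_mon 1).measurable
    have h2 := measurable_expChar t
    fun_prop
  · filter_upwards [self_mem_nhdsWithin] with s hst p
    have hst' : 0 < |s - t| := abs_pos.2 (sub_ne_zero.2 hst)
    rw [Pi.smul_apply, Pi.sub_apply, Pi.mul_apply, Pi.mul_apply, ← sub_mul, norm_smul, norm_mul,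
      Pi.mul_apply, norm_mul, norm_mon, pow_one, ← mul_assoc, norm_inv, Complex.norm_real,
      Real.norm_eq_abs]
    refine mul_le_mul_of_nonneg_right ?_ (norm_nonneg _)
    rw [inv_mul_le_iff₀ hst']
    exact norm_expChar_sub_le s t p
  · rw [Pi.mul_apply, norm_mul, norm_expChar, one_mul]
  · have h := ((hasDerivAt_expChar p t).mul_const (g p))
    rw [hasDerivAt_iff_tendsto_slope] at h
    have h2 : (expChar t * (mon 1 * g)) p = mon 1 p * expChar t p * g p := by
      simp only [Pi.mul_apply]; ring
    rw [h2]
    refine h.congr fun s => ?_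
    rw [slope_def_module, Pi.smul_apply, Pi.sub_apply, Pi.mul_apply, Pi.mul_apply,
      ← Complex.ofReal_inv, Complex.coe_smul]

/-- A vector with an orbit map differentiable at `0` lies in the domain of `A`, by Fatou's lemma
applied to the difference quotients. -/
theorem memLp_mon_one_of_differentiableAt {v : H}
    (h : DifferentiableAt ℝ (fun t => ρ.U t v) 0) : MemLp (mon 1) 2 (ρ.specMeasure v) := by
  have hd := h.hasDerivAt
  rw [hasDerivAt_iff_tendsto_slope] at hd
  have hseq : Tendsto (fun n : ℕ => 1 / ((n : ℝ) + 1)) atTop (𝓝[≠] 0) :=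
    tendsto_nhdsWithin_iff.2 ⟨tendsto_one_div_add_atTop_nhds_zero_nat,
      Eventually.of_forall fun n => by simp only [mem_compl_iff, mem_singleton_iff]; positivity⟩
  set F : ℝ → ℝ → ℂ := fun s => ((s : ℂ))⁻¹ • (expChar s - expChar 0) with hF
  have hFm : ∀ s, MemLp (F s) 2 (ρ.specMeasure v) := fun s =>
    ((memLp_expChar _ s).sub (memLp_expChar _ 0)).const_smul _
  have hs : ∀ s, slope (fun s => ρ.U s v) 0 s = ρ.fc (F s) v := by
    intro s
    rw [hF, fc_smul _ ((memLp_expChar _ s).sub (memLp_expChar _ 0)),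
      fc_sub (memLp_expChar _ s) (memLp_expChar _ 0), slope_def_module, fc_expChar, fc_expChar,
      ← Complex.ofReal_inv, Complex.coe_smul, sub_zero]
  have h1 := (hd.comp hseq).norm
  have h2 := ENNReal.tendsto_ofReal h1
  have h3 : ∀ n : ℕ,
      ENNReal.ofReal ‖(slope (fun t => ρ.U t v) 0 ∘ fun n : ℕ => 1 / ((n : ℝ) + 1)) n‖
      = eLpNorm (F (1 / ((n : ℝ) + 1))) 2 (ρ.specMeasure v) := fun n => by
    rw [Function.comp_apply, hs, norm_fc (hFm _), ENNReal.ofReal_toReal (hFm _).2.ne]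
  simp only [h3] at h2
  refine ⟨(continuous_mon 1).aestronglyMeasurable, ?_⟩
  refine (Lp.eLpNorm_lim_le_liminf_eLpNorm (fun n : ℕ => (hFm (1 / ((n : ℝ) + 1))).1) _
    (ae_of_all _ fun p => ?_)).trans_lt (h2.liminf_eq.trans_lt ENNReal.ofReal_lt_top)
  have h4 := (hasDerivAt_iff_tendsto_slope.1 (hasDerivAt_expChar p 0)).comp hseq
  have h5 : mon 1 p * expChar 0 p = mon 1 p := by simp [expChar]
  rw [h5] at h4
  refine h4.congr fun n => ?_
  rw [Function.comp_apply, slope_def_module, sub_zero, hF]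
  simp only [Pi.smul_apply, Pi.sub_apply]
  rw [← Complex.ofReal_inv, Complex.coe_smul]

theorem iteratedDeriv_orbit_of_memLp {v : H} {n : ℕ}
    (h : ∀ k ≤ n, MemLp (mon k) 2 (ρ.specMeasure v)) :
    iteratedDeriv n (fun t => ρ.U t v) = fun t => ρ.fc (expChar t * mon n) v := by
  induction n with
  | zero =>
    funext t
    have : expChar t * mon 0 = expChar t := by funext p; simp [mon]
    rw [iteratedDeriv_zero, this, fc_expChar]
  | succ n ih =>
    rw [iteratedDeriv_succ, ih fun k hk => h k (hk.trans n.le_succ)]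
    funext t
    have h1 := h (n + 1) le_rfl
    rw [mon_succ] at h1 ⊢
    exact (hasDerivAt_fc_expChar (continuous_mon n).measurable (h n n.le_succ) h1 t).deriv

/-- A smooth vector lies in the domain of all powers of `A`. -/
theorem memLp_mon_of_contDiff {v : H} (h : ContDiff ℝ ∞ fun t => ρ.U t v) (n : ℕ) :
    MemLp (mon n) 2 (ρ.specMeasure v) := by
  induction n using Nat.strong_induction_on with
  | _ n ih =>
    cases n with
    | zero =>
      have : mon 0 = fun _ => 1 := by funext p; simp [mon]
      rw [this]; exact memLp_const 1
    | succ n =>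
      have h1 := iteratedDeriv_orbit_of_memLp (ρ := ρ) (n := n) fun k hk => ih k (by omega)
      have hn := ih n n.lt_succ_self
      have h2 : Differentiable ℝ (iteratedDeriv n fun t => ρ.U t v) :=
        h.differentiable_iteratedDeriv n (by exact_mod_cast ENat.natCast_lt_top n)
      rw [h1] at h2
      simp only [← U_fc hn] at h2
      have h3 := memLp_mon_one_of_differentiableAt (h2 0)
      rw [memLp_specMeasure_fc_iff (continuous_mon n).measurable hn
        (continuous_mon 1).measurable] at h3
      rwa [mon_succ]

theorem contDiff_of_memLp_mon {v : H} (h : ∀ n, MemLp (mon n) 2 (ρ.specMeasure v)) :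
    ContDiff ℝ ∞ fun t => ρ.U t v := by
  refine contDiff_of_differentiable_iteratedDeriv fun n _ => ?_
  rw [iteratedDeriv_orbit_of_memLp fun k _ => h k]
  intro t
  refine (hasDerivAt_fc_expChar (continuous_mon n).measurable (h n) ?_ t).differentiableAt
  rw [← mon_succ]
  exact h (n + 1)

theorem memLp_mon (φ : ρ.SmoothVectors) (n : ℕ) :
    MemLp (mon n) 2 (ρ.specMeasure (ρ.smoothIncl φ)) :=
  memLp_mon_of_contDiff (ρ.contDiff_orbit φ) n

theorem memLp_wt (φ : ρ.SmoothVectors) (n : ℕ) :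
    MemLp (wt n) 2 (ρ.specMeasure (ρ.smoothIncl φ)) := by
  rw [wt_eq_sum]
  exact memLp_finsetSum' _ fun k _ => (memLp_mon φ k).const_smul _

theorem orbitDeriv_eq (φ : ρ.SmoothVectors) (n : ℕ) :
    ρ.orbitDeriv n φ = ρ.fc (mon n) (ρ.smoothIncl φ) := by
  change iteratedDeriv n (fun t => ρ.U t (ρ.smoothIncl φ)) 0 = _
  rw [iteratedDeriv_orbit_of_memLp fun k _ => memLp_mon φ k]
  have : expChar 0 * mon n = mon n := by funext p; simp [expChar]
  simp only [this]

theorem wtOp_apply (n : ℕ) (φ : ρ.SmoothVectors) :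
    ρ.wtOp n φ = ρ.fc (wt n) (ρ.smoothIncl φ) := by
  rw [wt_eq_sum, fc_sum _ fun k _ => (memLp_mon φ k).const_smul _, wtOp, LinearMap.sum_apply]
  refine Finset.sum_congr rfl fun k _ => ?_
  rw [fc_smul _ (memLp_mon φ k), LinearMap.smul_apply, orbitDeriv_eq]

theorem wtDist_apply (n : ℕ) (x : H) (φ : ρ.SmoothVectors) :
    ρ.wtDist n x φ = inner ℂ (ρ.fc (wt n) (ρ.smoothIncl φ)) x := by
  rw [← wtOp_apply]; rfl

variable (ρ) in
/-- A vector in the domain of all powers of `A` as a smooth vector. -/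
def mkSmooth (v : H) (h : ∀ n, MemLp (mon n) 2 (ρ.specMeasure v)) : ρ.SmoothVectors :=
  ⟨v, contDiff_of_memLp_mon h⟩

@[simp] theorem smoothIncl_mkSmooth (v : H) (h : ∀ n, MemLp (mon n) 2 (ρ.specMeasure v)) :
    ρ.smoothIncl (ρ.mkSmooth v h) = v := rfl

end AntiunitaryRep

/-! ### Distribution vectors -/

/-- The inverse of the conjugate weight, `p ↦ (1 - ip)⁻ⁿ`. -/
noncomputable def iw (n : ℕ) (p : ℝ) : ℂ := (conj (wt n p))⁻¹

/-- The exponential `p ↦ exp (sp)`, the symbol of `exp (sA)`. -/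
noncomputable def ex (s : ℂ) (p : ℝ) : ℂ := Complex.exp (s * p)

/-- The indicator function of `[-R, R]`. -/
noncomputable def cutoff (R : ℕ) : ℝ → ℂ := ind (Icc (-(R : ℝ)) R)

theorem continuous_iw (n : ℕ) : Continuous (iw n) := by
  unfold iw
  exact (Complex.continuous_conj.comp (continuous_wt n)).inv₀ fun p h =>
    wt_ne_zero n p (by simpa using h)

theorem continuous_ex (s : ℂ) : Continuous (ex s) := by unfold ex; fun_prop

theorem measurable_cutoff (R : ℕ) : Measurable (cutoff R) := measurable_ind measurableSet_Icc

theorem norm_ex (s : ℂ) (p : ℝ) : ‖ex s p‖ = Real.exp (s.re * p) := by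
  simp [ex, Complex.norm_exp]

theorem ex_add (s t : ℂ) : ex (s + t) = ex s * ex t := by
  funext p
  simp only [ex, Pi.mul_apply, ← Complex.exp_add]
  congr 1
  ring

theorem ex_zero : ex 0 = 1 := by funext p; simp [ex]

theorem conj_ex_neg (s : ℝ) (p : ℝ) : conj (ex s (-p)) = ex (-s) p := by
  simp [ex, ← Complex.exp_conj]

theorem norm_iw (n : ℕ) (p : ℝ) : ‖iw n p‖ = ‖wt n p‖⁻¹ := by
  rw [iw, norm_inv, RCLike.norm_conj]

theorem norm_iw_le_one (n : ℕ) (p : ℝ) : ‖iw n p‖ ≤ 1 := by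
  rw [norm_iw]; exact inv_le_one_of_one_le₀ (one_le_norm_wt n p)

theorem norm_iw_anti {m n : ℕ} (h : m ≤ n) (p : ℝ) : ‖iw n p‖ ≤ ‖iw m p‖ := by
  rw [norm_iw, norm_iw, wt, wt, norm_pow, norm_pow]
  have := one_le_norm_one_add_I_mul p
  gcongr

theorem conj_wt_mul_iw (n : ℕ) (p : ℝ) : conj (wt n p) * iw n p = 1 :=
  mul_inv_cancel₀ ((map_ne_zero _).2 (wt_ne_zero n p))

theorem conj_iw_neg (n : ℕ) (p : ℝ) : conj (iw n (-p)) = iw n p := by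
  rw [iw, iw, map_inv₀, conj_wt_neg, ← conj_wt_neg n p, Complex.conj_conj,
    ← conj_wt_neg n (-p), neg_neg]

theorem norm_cutoff_le (R : ℕ) (p : ℝ) : ‖cutoff R p‖ ≤ 1 := norm_ind_le _ _

theorem MeasureTheory.MemLp.bounded_mul {μ : Measure ℝ} {f k : ℝ → ℂ} (hf : MemLp f 2 μ)
    (hk : Measurable k) {C : ℝ} (hC : ∀ p, ‖k p‖ ≤ C) : MemLp (k * f) 2 μ :=
  hf.of_le_mul (hk.aestronglyMeasurable.mul hf.1) (ae_of_all _ fun p => by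
    rw [Pi.mul_apply, norm_mul]
    exact mul_le_mul_of_nonneg_right (hC p) (norm_nonneg _))

theorem memLp_of_norm_le {μ : Measure ℝ} [IsFiniteMeasure μ] {k : ℝ → ℂ} (hk : Measurable k)
    {C : ℝ} (hC : ∀ p, ‖k p‖ ≤ C) : MemLp k 2 μ :=
  MemLp.of_bound hk.aestronglyMeasurable C (ae_of_all _ hC)

/-- A continuous function is bounded on every interval `[-R, R]`. -/
theorem exists_norm_cutoff_mul_le {k : ℝ → ℂ} (hk : Continuous k) (R : ℕ) :
    ∃ C : ℝ, ∀ p, ‖(cutoff R * k) p‖ ≤ C := by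
  obtain ⟨C, hC⟩ := (isCompact_Icc (a := -(R : ℝ)) (b := R)).exists_bound_of_continuousOn
    hk.continuousOn
  refine ⟨max C 0, fun p => ?_⟩
  by_cases hp : p ∈ Icc (-(R : ℝ)) R
  · simp only [cutoff, ind, Pi.mul_apply, indicator_of_mem hp, one_mul]
    exact (hC p hp).trans (le_max_left _ _)
  · simp only [cutoff, ind, Pi.mul_apply, indicator_of_notMem hp, zero_mul, norm_zero]
    exact le_max_right _ _

theorem memLp_cutoff_mul {μ : Measure ℝ} [IsFiniteMeasure μ] {k : ℝ → ℂ} (hk : Continuous k)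
    (R : ℕ) : MemLp (cutoff R * k) 2 μ := by
  obtain ⟨C, hC⟩ := exists_norm_cutoff_mul_le hk R
  exact memLp_of_norm_le ((measurable_cutoff R).mul hk.measurable) hC

theorem tendsto_cutoff (p : ℝ) : Tendsto (fun R : ℕ => cutoff R p) atTop (𝓝 1) := by
  obtain ⟨n, hn⟩ := exists_nat_ge |p|
  refine tendsto_const_nhds.congr' ?_
  filter_upwards [eventually_ge_atTop n] with R hR
  have hR' : |p| ≤ (R : ℝ) := hn.trans (by exact_mod_cast hR)
  have : p ∈ Icc (-(R : ℝ)) R := abs_le.1 hR'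
  simp only [cutoff, ind, indicator_of_mem this]

namespace AntiunitaryRep

variable {H : Type*} [NormedAddCommGroup H] [InnerProductSpace ℂ H] [CompleteSpace H]
  {ρ : AntiunitaryRep H}

theorem memLp_mon_fc {f : ℝ → ℂ} {v : H} (hfm : Measurable f)
    (hf : MemLp f 2 (ρ.specMeasure v)) (h : ∀ n, MemLp (mon n * f) 2 (ρ.specMeasure v)) (n : ℕ) :
    MemLp (mon n) 2 (ρ.specMeasure (ρ.fc f v)) :=
  (memLp_specMeasure_fc_iff hfm hf (continuous_mon n).measurable).2 (h n)

theorem tendsto_fc_cutoff {f : ℝ → ℂ} {v : H} (hfm : Measurable f)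
    (hf : MemLp f 2 (ρ.specMeasure v)) :
    Tendsto (fun R : ℕ => ρ.fc (cutoff R * f) v) atTop (𝓝 (ρ.fc f v)) := by
  refine tendsto_fc_of_dominated (b := fun p => ‖f p‖) hf.norm
    (Eventually.of_forall fun R => (measurable_cutoff R).mul hfm) hfm
    (Eventually.of_forall fun R p => ?_) (fun _ => le_rfl) fun p => ?_
  · rw [Pi.mul_apply, norm_mul]
    exact mul_le_of_le_one_left (norm_nonneg _) (norm_cutoff_le R p)
  · simpa using (tendsto_cutoff p).mul_const (f p)

/-- Moving the weight `(1 + iA)ⁿ` to the smooth vector. -/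
theorem embed_fc {f : ℝ → ℂ} {v : H} (hfm : Measurable f) (hf : MemLp f 2 (ρ.specMeasure v))
    (n : ℕ) : ρ.embed (ρ.fc f v) = ρ.wtDist n (ρ.fc (iw n * f) v) := by
  apply ContinuousLinearMap.ext
  intro φ
  change ρ.embed (ρ.fc f v) φ = ρ.wtDist n (ρ.fc (iw n * f) v) φ
  have hif : MemLp (iw n * f) 2 (ρ.specMeasure v) :=
    hf.bounded_mul (continuous_iw n).measurable (norm_iw_le_one n)
  have him := (continuous_iw n).measurable.mul hfm
  have hc : Measurable fun p => conj (wt n p) :=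
    (Complex.continuous_conj.comp (continuous_wt n)).measurable
  have he : (fun p => conj (wt n p)) * (iw n * f) = f := by
    funext p
    simp only [Pi.mul_apply]
    rw [← mul_assoc, conj_wt_mul_iw, one_mul]
  have h1 : ρ.fc (fun p => conj (wt n p)) (ρ.fc (iw n * f) v) = ρ.fc f v := by
    rw [fc_fc him hc hif (by rwa [he]), he]
  rw [embed_apply, wtDist_apply, ← h1, inner_fc_right
    ((memLp_specMeasure_fc_iff him hif hc).2 (by rwa [he])) (memLp_conj (memLp_wt φ n))]
  simp only [Complex.conj_conj]

theorem continuous_wt_inv (n : ℕ) : Continuous fun p => (wt n p)⁻¹ :=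
  (continuous_wt n).inv₀ (wt_ne_zero n)

variable (ρ) in
/-- The smooth vector `φ` with `(1 + iA)ⁿ φ = 1_{[-R, R]}(A) x`. -/
noncomputable def cutVec (n R : ℕ) (x : H) : ρ.SmoothVectors :=
  ρ.mkSmooth (ρ.fc (cutoff R * fun p => (wt n p)⁻¹) x)
    (memLp_mon_fc ((measurable_cutoff R).mul (continuous_wt_inv n).measurable)
      (memLp_cutoff_mul (continuous_wt_inv n) R) fun k => by
        rw [mul_left_comm]
        exact memLp_cutoff_mul ((continuous_mon k).mul (continuous_wt_inv n)) R)

theorem fc_wt_cutVec (n R : ℕ) (x : H) :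
    ρ.fc (wt n) (ρ.smoothIncl (ρ.cutVec n R x)) = ρ.fc (cutoff R) x := by
  have he : wt n * (cutoff R * fun p => (wt n p)⁻¹) = cutoff R := by
    funext p
    simp only [Pi.mul_apply]
    rw [mul_left_comm, mul_inv_cancel₀ (wt_ne_zero n p), mul_one]
  rw [cutVec, smoothIncl_mkSmooth,
    fc_fc ((measurable_cutoff R).mul (continuous_wt_inv n).measurable)
    (continuous_wt n).measurable (memLp_cutoff_mul (continuous_wt_inv n) R), he]
  rw [he]
  exact memLp_of_norm_le (measurable_cutoff R) (norm_cutoff_le R)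

theorem tendsto_fc_cutoff_self (x : H) :
    Tendsto (fun R : ℕ => ρ.fc (cutoff R) x) atTop (𝓝 x) := by
  have h := tendsto_fc_cutoff (ρ := ρ) (v := x) (f := fun _ => 1) measurable_const (memLp_const 1)
  rw [fc_one] at h
  refine h.congr fun R => ?_
  congr 1
  funext p
  simp

/-- The map `x ↦ (1 - iA)ⁿ x` from `H` to the distribution vectors is injective. -/
theorem wtDist_injective (n : ℕ) : Function.Injective (ρ.wtDist n) := by
  intro x y hxy
  have h : ∀ z : H, ∀ R : ℕ, inner ℂ (ρ.fc (cutoff R) z) x = inner ℂ (ρ.fc (cutoff R) z) y := by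
    intro z R
    have := DFunLike.congr_fun hxy (ρ.cutVec n R z)
    rwa [wtDist_apply, wtDist_apply, fc_wt_cutVec] at this
  refine ext_inner_left ℂ fun z => ?_
  have h1 := (tendsto_fc_cutoff_self (ρ := ρ) z).inner (𝕜 := ℂ) (tendsto_const_nhds (x := x))
  have h2 := (tendsto_fc_cutoff_self (ρ := ρ) z).inner (𝕜 := ℂ) (tendsto_const_nhds (x := y))
  simp only [h] at h1
  exact tendsto_nhds_unique h1 h2

theorem norm_fc_le_norm_fc {f g : ℝ → ℂ} {v : H} (hf : MemLp f 2 (ρ.specMeasure v))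
    (hg : MemLp g 2 (ρ.specMeasure v)) (h : ∀ p, ‖f p‖ ≤ ‖g p‖) : ‖ρ.fc f v‖ ≤ ‖ρ.fc g v‖ := by
  rw [norm_fc hf, norm_fc hg]
  exact ENNReal.toReal_mono hg.2.ne (eLpNorm_mono h)

/-- The operator `(1 + iA)⁻ⁿ` on smooth vectors. -/
noncomputable def wtInv (ρ : AntiunitaryRep H) (n : ℕ) :
    ρ.smoothSubmodule →ₗ[ℂ] ρ.SmoothVectors where
  toFun ψ := ρ.mkSmooth (ρ.fc (fun p => (wt n p)⁻¹) (ψ : H))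
    (memLp_mon_fc (continuous_wt_inv n).measurable
      (memLp_of_norm_le (C := 1) (continuous_wt_inv n).measurable fun p => by
        rw [norm_inv]; exact inv_le_one_of_one_le₀ (one_le_norm_wt n p))
      fun k => by
        rw [mul_comm]
        exact (memLp_mon_of_contDiff ψ.2 k).bounded_mul (C := 1)
          (continuous_wt_inv n).measurable fun p => by
            rw [norm_inv]; exact inv_le_one_of_one_le₀ (one_le_norm_wt n p))
  map_add' ψ χ := by
    refine Subtype.ext ?_
    exact fc_add_vec (continuous_wt_inv n).measurable (C := 1) (fun p => by
      rw [norm_inv]; exact inv_le_one_of_one_le₀ (one_le_norm_wt n p)) _ _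
  map_smul' c ψ := by
    refine Subtype.ext ?_
    have h : ∀ v, MemLp (fun p => (wt n p)⁻¹) 2 (ρ.specMeasure v) := fun v =>
      memLp_of_norm_le (C := 1) (continuous_wt_inv n).measurable fun p => by
        rw [norm_inv]; exact inv_le_one_of_one_le₀ (one_le_norm_wt n p)
    exact fc_smul_vec c (h _) (h _)

theorem smoothIncl_wtInv (n : ℕ) (ψ : ρ.smoothSubmodule) :
    ρ.smoothIncl (ρ.wtInv n ψ) = ρ.fc (fun p => (wt n p)⁻¹) (ψ : H) := rfl

theorem fc_wt_wtInv (n : ℕ) (ψ : ρ.smoothSubmodule) :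
    ρ.fc (wt n) (ρ.smoothIncl (ρ.wtInv n ψ)) = ψ := by
  have h : ∀ v, MemLp (fun p => (wt n p)⁻¹) 2 (ρ.specMeasure v) := fun v =>
    memLp_of_norm_le (C := 1) (continuous_wt_inv n).measurable fun p => by
      rw [norm_inv]; exact inv_le_one_of_one_le₀ (one_le_norm_wt n p)
  have he : (wt n * fun p => (wt n p)⁻¹) = fun _ => 1 := by
    funext p; simp [wt_ne_zero]
  rw [smoothIncl_wtInv, fc_fc (continuous_wt_inv n).measurable (continuous_wt n).measurable (h _)
    (by rw [he]; exact memLp_const 1), he, fc_one]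

theorem memLp_mon_fc_wt (n : ℕ) (φ : ρ.SmoothVectors) (k : ℕ) :
    MemLp (mon k) 2 (ρ.specMeasure (ρ.fc (wt n) (ρ.smoothIncl φ))) := by
  refine memLp_mon_fc (continuous_wt n).measurable (memLp_wt φ n) (fun k => ?_) k
  refine (memLp_wt φ (k + n)).of_le
    ((continuous_mon k).mul (continuous_wt n)).aestronglyMeasurable (ae_of_all _ fun p => ?_)
  have : wt (k + n) p = wt k p * wt n p := by simp [wt, pow_add]
  rw [this, Pi.mul_apply, norm_mul, norm_mul]
  exact mul_le_mul_of_nonneg_right (norm_mon_le_norm_wt le_rfl p) (norm_nonneg _)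

theorem wtInv_fc_wt (n : ℕ) (φ : ρ.SmoothVectors)
    (h : ContDiff ℝ ∞ fun t => ρ.U t (ρ.fc (wt n) (ρ.smoothIncl φ))) :
    ρ.wtInv n ⟨ρ.fc (wt n) (ρ.smoothIncl φ), h⟩ = φ := by
  refine Subtype.ext ?_
  change ρ.fc (fun p => (wt n p)⁻¹) (ρ.fc (wt n) (ρ.smoothIncl φ)) = ρ.smoothIncl φ
  have he : ((fun p => (wt n p)⁻¹) * wt n) = fun _ => 1 := by
    funext p; simp [wt_ne_zero]
  rw [fc_fc (continuous_wt n).measurable (continuous_wt_inv n).measurable (memLp_wt φ n)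
    (by rw [he]; exact memLp_const 1), he, fc_one]

/-- Every distribution vector is of the form `(1 - iA)ⁿ u` with `u ∈ H`: it is bounded by one of the
defining seminorms, hence by `φ ↦ ‖(1 + iA)ⁿ φ‖`, and the Riesz representation theorem applies. -/
theorem exists_eq_wtDist (η : ρ.DistVectors) : ∃ (n : ℕ) (u : H), η = ρ.wtDist n u := by
  let ηc : ρ.SmoothVectors →L⋆[ℂ] ℂ := η
  obtain ⟨s, C, -, hC⟩ := Seminorm.bound_of_continuous ρ.withSeminorms_smoothSeminorm
    ((normSeminorm ℂ ℂ).comp ηc.toLinearMap) (by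
      change Continuous fun φ => ‖ηc φ‖
      exact ηc.continuous.norm)
  set n := s.sup id with hn
  have hbound : ∀ φ, ‖ηc φ‖ ≤ C * ‖ρ.fc (wt n) (ρ.smoothIncl φ)‖ := by
    intro φ
    refine (hC φ).trans ?_
    rw [smul_apply]
    refine mul_le_mul_of_nonneg_left ?_ C.2
    refine Seminorm.finset_sup_apply_le (norm_nonneg _) fun k hk => ?_
    change ‖ρ.orbitDeriv k φ‖ ≤ _
    rw [orbitDeriv_eq]
    exact norm_fc_le_norm_fc (memLp_mon φ k) (memLp_wt φ n)
      (norm_mon_le_norm_wt (Finset.le_sup (f := id) hk))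
  -- with `ψ = (1 + iA)ⁿ φ`, the functional `ψ ↦ conj (η φ)` is bounded for the norm of `H`
  let ℓ : ρ.smoothSubmodule →ₗ[ℂ] ℂ :=
    { toFun := fun ψ => conj (ηc (ρ.wtInv n ψ))
      map_add' := fun ψ χ => by rw [map_add, map_add, map_add]
      map_smul' := fun c ψ => by
        rw [map_smul, map_smulₛₗ, smul_eq_mul, map_mul, Complex.conj_conj]; rfl }
  let ℓc : StrongDual ℂ ρ.smoothSubmodule := ℓ.mkContinuous C fun ψ => by
    change ‖conj (ηc (ρ.wtInv n ψ))‖ ≤ _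
    rw [RCLike.norm_conj]
    refine (hbound _).trans_eq ?_
    rw [fc_wt_wtInv]
    rfl
  obtain ⟨G, hG, -⟩ := exists_extension_norm_eq ρ.smoothSubmodule ℓc
  refine ⟨n, (InnerProductSpace.toDual ℂ H).symm G, ?_⟩
  apply ContinuousLinearMap.ext
  intro φ
  change ηc φ = ρ.wtDist n _ φ
  have hsm := contDiff_of_memLp_mon (memLp_mon_fc_wt n φ)
  rw [wtDist_apply, ← inner_conj_symm, InnerProductSpace.toDual_symm_apply]
  have h1 := hG ⟨ρ.fc (wt n) (ρ.smoothIncl φ), hsm⟩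
  have h2 : G (ρ.fc (wt n) (ρ.smoothIncl φ)) =
      conj (ηc (ρ.wtInv n ⟨ρ.fc (wt n) (ρ.smoothIncl φ), hsm⟩)) := h1
  rw [h2, wtInv_fc_wt, Complex.conj_conj]

end AntiunitaryRep

/-! ### Exponential weights and temperedness -/

theorem exp_abs_le (x : ℝ) : Real.exp |x| ≤ Real.exp x + Real.exp (-x) := by
  rcases abs_cases x with ⟨h, -⟩ | ⟨h, -⟩ <;> rw [h] <;>
    linarith [Real.exp_pos x, Real.exp_pos (-x)]

theorem exp_mul_le_of_abs_le {a c : ℝ} (hc : |c| ≤ a) (p : ℝ) :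
    Real.exp (c * p) ≤ Real.exp (a * p) + Real.exp (-a * p) := by
  have h1 := exp_abs_le (a * p)
  rw [← neg_mul] at h1
  refine le_trans (Real.exp_le_exp.2 ?_) h1
  refine (le_abs_self _).trans ?_
  rw [abs_mul, abs_mul]
  exact mul_le_mul_of_nonneg_right (hc.trans (le_abs_self a)) (abs_nonneg p)

/-- Polynomial weights grow slower than exponentials. -/
theorem exists_norm_wt_le_exp (n : ℕ) {δ : ℝ} (hδ : 0 < δ) :
    ∃ C : ℝ, 0 < C ∧ ∀ p, ‖wt n p‖ ≤ C * Real.exp (δ * |p|) := by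
  rcases Nat.eq_zero_or_pos n with rfl | hn
  · refine ⟨1, one_pos, fun p => ?_⟩
    simp only [wt, pow_zero, norm_one, one_mul]
    exact Real.one_le_exp (by positivity)
  have hn' : (0 : ℝ) < n := by exact_mod_cast hn
  set ε := δ / n with hε
  have hε0 : 0 < ε := div_pos hδ hn'
  refine ⟨(1 + 1 / ε) ^ n, by positivity, fun p => ?_⟩
  have h1 : ‖1 + Complex.I * (p : ℂ)‖ ≤ (1 + 1 / ε) * Real.exp (ε * |p|) := by
    have h2 : ‖1 + Complex.I * (p : ℂ)‖ ≤ 1 + |p| := by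
      refine (norm_add_le _ _).trans ?_
      simp
    have h3 : ε * |p| + 1 ≤ Real.exp (ε * |p|) := Real.add_one_le_exp _
    refine h2.trans (le_trans ?_ (mul_le_mul_of_nonneg_left h3 (by positivity)))
    have h4 : (1 + 1 / ε) * (ε * |p| + 1) = 1 + |p| + ε * |p| + 1 / ε := by
      field_simp; ring
    rw [h4]
    have : 0 ≤ ε * |p| := by positivity
    have : 0 ≤ 1 / ε := by positivity
    linarith
  rw [wt, norm_pow]
  refine (pow_le_pow_left₀ (norm_nonneg _) h1 n).trans_eq ?_
  rw [mul_pow, ← Real.exp_nat_mul]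
  congr 2
  rw [hε]
  field_simp

theorem abs_le_inv_mul_exp {δ : ℝ} (hδ : 0 < δ) (p : ℝ) : |p| ≤ δ⁻¹ * Real.exp (δ * |p|) := by
  rw [le_inv_mul_iff₀ hδ]
  linarith [Real.add_one_le_exp (δ * |p|)]

theorem hasDerivAt_ex (s : ℂ) (p : ℝ) : HasDerivAt (fun z => ex z p) (p * ex s p) s := by
  have h := ((hasDerivAt_id s).mul_const (p : ℂ)).cexp
  simp only [id_eq, one_mul] at h
  rw [mul_comm]
  exact h

/-- The bound on difference quotients behind holomorphy of `s ↦ exp (sA)`. -/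
theorem norm_slope_ex_le {s y : ℂ} {δ a : ℝ} (hδ : 0 < δ) (hs : |s.re| + 2 * δ ≤ a)
    (hy : ‖y - s‖ ≤ δ) (hne : y ≠ s) (p : ℝ) :
    ‖(y - s)⁻¹ * (ex y p - ex s p)‖ ≤ δ⁻¹ * (Real.exp (a * p) + Real.exp (-a * p)) := by
  have hpos : 0 < ‖y - s‖ := norm_pos_iff.2 (sub_ne_zero.2 hne)
  have h1 : ex y p - ex s p = ex s p * (Complex.exp ((y - s) * p) - 1) := by
    simp only [ex]
    rw [mul_sub, mul_one, ← Complex.exp_add]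
    congr 2
    ring
  have h2 : ‖Complex.exp ((y - s) * p) - 1‖ ≤ ‖y - s‖ * |p| * Real.exp (δ * |p|) := by
    have h3 := Complex.norm_exp_sub_sum_le_norm_mul_exp ((y - s) * p) 1
    simp only [Finset.range_one, Finset.sum_singleton, pow_zero, Nat.factorial_zero, Nat.cast_one,
      div_one, pow_one, norm_mul, Complex.norm_real, Real.norm_eq_abs] at h3
    refine h3.trans (mul_le_mul_of_nonneg_left (Real.exp_le_exp.2 ?_) (by positivity))
    exact mul_le_mul_of_nonneg_right hy (abs_nonneg p)
  rw [h1, norm_mul, norm_mul, norm_inv, norm_ex, inv_mul_le_iff₀ hpos]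
  have h4 : Real.exp (s.re * p) ≤ Real.exp (|s.re| * |p|) := by
    rw [← abs_mul]; exact Real.exp_le_exp.2 (le_abs_self _)
  have h5 : Real.exp ((|s.re| + 2 * δ) * |p|) ≤ Real.exp (a * p) + Real.exp (-a * p) := by
    refine le_trans (Real.exp_le_exp.2 ?_) ((exp_abs_le (a * p)).trans_eq (by rw [neg_mul]))
    rw [abs_mul]
    exact mul_le_mul_of_nonneg_right (hs.trans (le_abs_self a)) (abs_nonneg p)
  calc Real.exp (s.re * p) * ‖Complex.exp ((y - s) * p) - 1‖
      ≤ Real.exp (|s.re| * |p|) * (‖y - s‖ * (δ⁻¹ * Real.exp (δ * |p|)) * Real.exp (δ * |p|)) := by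
        refine mul_le_mul h4 (h2.trans ?_) (norm_nonneg _) (Real.exp_pos _).le
        gcongr
        exact abs_le_inv_mul_exp hδ p
    _ = ‖y - s‖ * (δ⁻¹ * Real.exp ((|s.re| + 2 * δ) * |p|)) := by
        have : (|s.re| + 2 * δ) * |p| = |s.re| * |p| + δ * |p| + δ * |p| := by ring
        rw [this, Real.exp_add, Real.exp_add]
        ring
    _ ≤ ‖y - s‖ * (δ⁻¹ * (Real.exp (a * p) + Real.exp (-a * p))) := by gcongr

namespace AntiunitaryRep

variable {H : Type*} [NormedAddCommGroup H] [InnerProductSpace ℂ H] [CompleteSpace H]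
  {ρ : AntiunitaryRep H} {h : ℝ → ℂ} {v : H} {a : ℝ}

theorem memLp_strip_bound (hp : MemLp (ex a * h) 2 (ρ.specMeasure v))
    (hm : MemLp (ex (-a) * h) 2 (ρ.specMeasure v)) :
    MemLp (fun p => (Real.exp (a * p) + Real.exp (-a * p)) * ‖h p‖) 2 (ρ.specMeasure v) := by
  refine (hp.norm.add hm.norm).ae_eq (ae_of_all _ fun p => ?_)
  simp [norm_ex, add_mul]

theorem memLp_ex_mul (hh : Measurable h) (hp : MemLp (ex a * h) 2 (ρ.specMeasure v))
    (hm : MemLp (ex (-a) * h) 2 (ρ.specMeasure v)) {s : ℂ} (hs : |s.re| ≤ a) :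
    MemLp (ex s * h) 2 (ρ.specMeasure v) := by
  refine (memLp_strip_bound hp hm).mono' ((continuous_ex s).measurable.mul hh).aestronglyMeasurable
    (ae_of_all _ fun p => ?_)
  rw [Pi.mul_apply, norm_mul, norm_ex]
  exact mul_le_mul_of_nonneg_right (exp_mul_le_of_abs_le hs p) (norm_nonneg _)

theorem continuousOn_fc_ex (hh : Measurable h) (hp : MemLp (ex a * h) 2 (ρ.specMeasure v))
    (hm : MemLp (ex (-a) * h) 2 (ρ.specMeasure v)) :
    ContinuousOn (fun s => ρ.fc (ex s * h) v) {s | |s.re| ≤ a} := by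
  have hb : ∀ s : ℂ, |s.re| ≤ a → ∀ p,
      ‖(ex s * h) p‖ ≤ (Real.exp (a * p) + Real.exp (-a * p)) * ‖h p‖ := fun s hs p => by
    rw [Pi.mul_apply, norm_mul, norm_ex]
    exact mul_le_mul_of_nonneg_right (exp_mul_le_of_abs_le hs p) (norm_nonneg _)
  intro s hs
  refine tendsto_fc_of_dominated (memLp_strip_bound hp hm)
    (Eventually.of_forall fun y => (continuous_ex y).measurable.mul hh)
    ((continuous_ex s).measurable.mul hh) ?_ (hb s hs) fun p => ?_
  · filter_upwards [self_mem_nhdsWithin] with y hy using hb y hy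
  · exact ((hasDerivAt_ex s p).continuousAt.mul continuousAt_const).continuousWithinAt

theorem differentiableAt_fc_ex (hh : Measurable h) (hp : MemLp (ex a * h) 2 (ρ.specMeasure v))
    (hm : MemLp (ex (-a) * h) 2 (ρ.specMeasure v)) {s : ℂ} (hs : |s.re| < a) :
    DifferentiableAt ℂ (fun s => ρ.fc (ex s * h) v) s := by
  obtain ⟨δ, hδ, hδa⟩ : ∃ δ : ℝ, 0 < δ ∧ |s.re| + 2 * δ ≤ a :=
    ⟨(a - |s.re|) / 2, by linarith, by linarith⟩
  have hnear : ∀ᶠ y in 𝓝[≠] s, y ≠ s ∧ ‖y - s‖ ≤ δ ∧ |y.re| ≤ a := by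
    filter_upwards [self_mem_nhdsWithin,
      mem_nhdsWithin_of_mem_nhds (Metric.closedBall_mem_nhds s hδ)]
      with y hy hy2
    have h1 : ‖y - s‖ ≤ δ := by rwa [← dist_eq_norm]
    refine ⟨hy, h1, ?_⟩
    have h2 := (Complex.abs_re_le_norm (y - s)).trans h1
    have h3 : y.re = s.re + (y - s).re := by simp
    rw [h3]
    exact (abs_add_le _ _).trans (by linarith)
  have hlim : Tendsto (fun y => ρ.fc ((y - s)⁻¹ • (ex y * h - ex s * h)) v) (𝓝[≠] s)
      (𝓝 (ρ.fc (fun p => p * ex s p * h p) v)) := by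
    have hslope : ∀ p, Tendsto (fun y => ((y - s)⁻¹ • (ex y * h - ex s * h)) p) (𝓝[≠] s)
        (𝓝 (p * ex s p * h p)) := fun p => by
      have h1 := hasDerivAt_iff_tendsto_slope.1 ((hasDerivAt_ex s p).mul_const (h p))
      refine h1.congr fun y => ?_
      rw [slope_def_module]
      rfl
    have hb : ∀ᶠ y in 𝓝[≠] s, ∀ p, ‖((y - s)⁻¹ • (ex y * h - ex s * h)) p‖ ≤
        δ⁻¹ * ((Real.exp (a * p) + Real.exp (-a * p)) * ‖h p‖) := by
      filter_upwards [hnear] with y ⟨hy, hyδ, _⟩ p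
      simp only [Pi.smul_apply, Pi.sub_apply, Pi.mul_apply, smul_eq_mul]
      rw [← sub_mul, ← mul_assoc, norm_mul, ← mul_assoc]
      exact mul_le_mul_of_nonneg_right (norm_slope_ex_le hδ hδa hyδ hy p) (norm_nonneg _)
    refine tendsto_fc_of_dominated ((memLp_strip_bound hp hm).const_mul δ⁻¹)
      (Eventually.of_forall fun y => ?_) ?_ hb (fun p => ?_) hslope
    · exact (((continuous_ex y).measurable.mul hh).sub
        ((continuous_ex s).measurable.mul hh)).const_smul (y - s)⁻¹
    · have := (continuous_ex s).measurable
      fun_prop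
    · exact le_of_tendsto (hslope p).norm (hb.mono fun y hy => hy p)
  refine HasDerivAt.differentiableAt (hasDerivAt_iff_tendsto_slope.2 (hlim.congr' ?_))
  filter_upwards [hnear] with y ⟨_, _, hya⟩
  have h1 := memLp_ex_mul hh hp hm hya
  have h2 := memLp_ex_mul hh hp hm hs.le
  rw [slope_def_module, fc_smul _ (h1.sub h2), fc_sub h1 h2]

/-- The spectral measure of a `J`-fixed vector is symmetric. -/
theorem memLp_of_J_fixed (hv : ρ.J v = v) {f : ℝ → ℂ} (hf : Measurable f)
    (h : MemLp (fun p => conj (f (-p))) 2 (ρ.specMeasure v)) : MemLp f 2 (ρ.specMeasure v) := by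
  refine ⟨hf.aestronglyMeasurable, ?_⟩
  have := eLpNorm_specMeasure_J (ρ := ρ) hf v
  rw [hv] at this
  rw [this]
  exact h.2

/-- For `J`-fixed `v` the measure `P^v` is symmetric, which exchanges the weights `exp (ap)` and
`exp (-ap)`. -/
theorem memLp_ex_neg_of_J_fixed (hv : ρ.J v = v) {n : ℕ}
    (hp : MemLp (ex a * iw n) 2 (ρ.specMeasure v)) :
    MemLp (ex (-a) * iw n) 2 (ρ.specMeasure v) := by
  refine memLp_of_J_fixed hv ((continuous_ex _).mul (continuous_iw n)).measurable ?_
  refine hp.ae_eq (ae_of_all _ fun p => ?_)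
  have := conj_ex_neg (-a) p
  push_cast at this
  rw [neg_neg] at this
  simp only [Pi.mul_apply, map_mul, conj_iw_neg, this]

theorem integrable_sq_ex_mul_iw_iff (n : ℕ) (v : H) :
    MemLp (ex (Real.pi / 2 : ℝ) * iw n) 2 (ρ.specMeasure v) ↔
      Integrable (fun p => Real.exp (Real.pi * p) * ((1 + p ^ 2) ^ n)⁻¹) (ρ.specMeasure v) := by
  rw [memLp_two_iff_integrable_sq_norm
    ((continuous_ex _).mul (continuous_iw n)).aestronglyMeasurable]
  refine integrable_congr (ae_of_all _ fun p => ?_)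
  simp only [Pi.mul_apply, norm_mul, mul_pow, norm_ex, norm_iw, Complex.ofReal_re]
  rw [← Real.exp_nat_mul, inv_pow, wt, norm_pow, ← pow_mul, mul_comm n 2, pow_mul,
    sq_norm_one_add_I_mul]
  congr 2
  push_cast
  ring

/-- Temperedness of `exp (πp) dP^v(p)`, in terms of the weights `(1 - ip)ⁿ`. -/
theorem mem_tempVectors_iff {v : H} : v ∈ ρ.spectral.tempVectors ρ ↔
    ρ.J v = v ∧ ∃ n, MemLp (ex (Real.pi / 2 : ℝ) * iw n) 2 (ρ.specMeasure v) := by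
  rw [SpectralMeasure.tempVectors, mem_ofPred_eq, measure_spectral]
  refine and_congr_right fun _ => ?_
  have hwd : ∀ n : ℕ, Integrable (fun p : ℝ => (1 + ‖p‖) ^ (-(n : ℝ)))
      ((ρ.specMeasure v).withDensity fun p => ENNReal.ofReal (Real.exp (Real.pi * p))) ↔
      Integrable (fun p : ℝ => Real.exp (Real.pi * p) * ((1 + |p|) ^ n)⁻¹) (ρ.specMeasure v) := by
    intro n
    rw [integrable_withDensity_iff_integrable_smul' (by fun_prop)
      (ae_of_all _ fun _ => ENNReal.ofReal_lt_top)]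
    refine integrable_congr (ae_of_all _ fun p => ?_)
    simp only
    rw [ENNReal.toReal_ofReal (Real.exp_pos _).le, Real.rpow_neg (by positivity),
      Real.rpow_natCast, smul_eq_mul, Real.norm_eq_abs]
  have hm : ∀ (q : ℝ → ℝ), Continuous q → (∀ p, q p ≠ 0) →
      AEStronglyMeasurable (fun p : ℝ => Real.exp (Real.pi * p) * (q p)⁻¹) (ρ.specMeasure v) :=
    fun q hq h0 => ((by fun_prop : Continuous fun p : ℝ => Real.exp (Real.pi * p)).mul
      (hq.inv₀ h0)).aestronglyMeasurable
  constructor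
  · rintro ⟨n, hn⟩
    refine ⟨n, (integrable_sq_ex_mul_iw_iff n v).2 ?_⟩
    rw [hwd] at hn
    refine (hn.const_mul ((2 : ℝ) ^ n)).mono' (hm _ (by fun_prop) fun p => by positivity)
      (ae_of_all _ fun p => ?_)
    rw [Real.norm_of_nonneg (by positivity), mul_left_comm]
    refine mul_le_mul_of_nonneg_left ?_ (Real.exp_pos _).le
    rw [← div_eq_mul_inv, ← div_pow, ← inv_pow]
    refine pow_le_pow_left₀ (by positivity) ?_ n
    rw [inv_eq_one_div, div_le_div_iff₀ (by positivity) (by positivity), one_mul]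
    nlinarith [sq_nonneg (|p| - 1), sq_abs p]
  · rintro ⟨n, hn⟩
    rw [integrable_sq_ex_mul_iw_iff] at hn
    refine ⟨2 * n, (hwd _).2 ?_⟩
    refine hn.mono' (hm _ (by fun_prop) fun p => by positivity) (ae_of_all _ fun p => ?_)
    rw [Real.norm_of_nonneg (by positivity)]
    refine mul_le_mul_of_nonneg_left ?_ (Real.exp_pos _).le
    rw [pow_mul]
    refine inv_anti₀ (by positivity) (pow_le_pow_left₀ (by positivity) ?_ n)
    nlinarith [abs_nonneg p, sq_abs p]

end AntiunitaryRep

/-! ### Uniqueness of boundary values on a strip -/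

/-- A function on a closed strip that vanishes on the real line vanishes near it: the product of
its four rotates about `z₀` vanishes on the boundary of the square with centre `z₀` and bottom side
on the real line. -/
theorem eq_zero_of_eq_zero_on_real {g : ℂ → ℂ} {b : ℝ}
    (hc : ContinuousOn g {z | 0 ≤ z.im ∧ z.im ≤ b})
    (hd : DifferentiableOn ℂ g {z | 0 < z.im ∧ z.im < b}) (h0 : ∀ t : ℝ, g t = 0)
    {z₀ : ℂ} (hz : 0 < z₀.im) (hzb : 2 * z₀.im ≤ b) : g z₀ = 0 := by
  set y := z₀.im with hy
  let Q : Set ℂ := Ioo (-y) y ×ℂ Ioo (-y) y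
  have hQo : IsOpen Q := isOpen_Ioo.reProdIm isOpen_Ioo
  have hQb : Bornology.IsBounded Q := (Metric.isBounded_Ioo _ _).reProdIm (Metric.isBounded_Ioo _ _)
  have hyy : -y ≠ y := by linarith
  have hQc : closure Q = Icc (-y) y ×ℂ Icc (-y) y := by
    rw [Complex.closure_reProdIm, closure_Ioo hyy]
  have hrot : ∀ c ∈ ({1, Complex.I, -1, -Complex.I} : Set ℂ),
      DiffContOnCl ℂ (fun ζ => g (z₀ + c * ζ)) Q := by
    intro c hcm
    refine ⟨hd.comp (by fun_prop) fun ζ hζ => ?_, ?_⟩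
    · obtain ⟨⟨h1, h2⟩, h3, h4⟩ := hζ
      rcases hcm with rfl | rfl | rfl | rfl <;>
      · simp only [mem_ofPred_eq, Complex.add_im, Complex.mul_im, Complex.neg_im, Complex.neg_re]
        simp
        constructor <;> linarith
    · refine hc.comp (by fun_prop) fun ζ hζ => ?_
      rw [hQc] at hζ
      obtain ⟨⟨h1, h2⟩, h3, h4⟩ := hζ
      rcases hcm with rfl | rfl | rfl | rfl <;>
      · simp only [mem_ofPred_eq, Complex.add_im, Complex.mul_im, Complex.neg_im, Complex.neg_re]
        simp
        constructor <;> linarith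
  have hreal : ∀ z : ℂ, z.im = 0 → g z = 0 := fun z hz => by
    have : z = (z.re : ℂ) := Complex.ext rfl (by simpa using hz)
    rw [this]; exact h0 _
  set G : ℂ → ℂ := fun ζ => g (z₀ + 1 * ζ) * (g (z₀ + Complex.I * ζ) *
    (g (z₀ + -1 * ζ) * g (z₀ + -Complex.I * ζ))) with hG
  have hGd : DiffContOnCl ℂ G Q :=
    (hrot _ (by simp)).smul ((hrot _ (by simp)).smul
      ((hrot _ (by simp)).smul (hrot _ (by simp))))
  have hGf : ∀ ζ ∈ frontier Q, ‖G ζ‖ ≤ 0 := by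
    intro ζ hζ
    rw [hQo.frontier_eq, hQc] at hζ
    obtain ⟨⟨⟨h1, h2⟩, h3, h4⟩, hn⟩ := hζ
    have hcases : ζ.im = -y ∨ ζ.re = -y ∨ ζ.im = y ∨ ζ.re = y := by
      by_contra! hcon
      obtain ⟨k1, k2, k3, k4⟩ := hcon
      exact hn ⟨⟨lt_of_le_of_ne h1 (Ne.symm k2), lt_of_le_of_ne h2 k4⟩,
        lt_of_le_of_ne h3 (Ne.symm k1), lt_of_le_of_ne h4 k3⟩
    have hGz : G ζ = 0 := by
      simp only [hG, mul_eq_zero]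
      rcases hcases with h | h | h | h
      · left; apply hreal; simp [h, ← hy]
      · right; left; apply hreal; simp [h, ← hy]
      · right; right; left; apply hreal; simp [h, ← hy]
      · right; right; right; apply hreal; simp [h, ← hy]
    rw [hGz, norm_zero]
  have hmem : (0 : ℂ) ∈ closure Q := by
    rw [hQc]; constructor <;> simp <;> linarith
  have := Complex.norm_le_of_forall_mem_frontier_norm_le hQb hGd hGf hmem
  have h4 : G 0 = g z₀ ^ 4 := by simp only [hG, mul_zero, add_zero]; ring
  rw [h4] at this
  exact pow_eq_zero_iff (n := 4) (by norm_num) |>.1 (norm_le_zero_iff.1 this)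

/-- Uniqueness of boundary values: a function continuous on a closed strip and holomorphic in its
interior is zero if it vanishes on the real line. -/
theorem eqOn_zero_of_eq_zero_on_real {g : ℂ → ℂ} {b : ℝ} (hb : 0 < b)
    (hc : ContinuousOn g {z | 0 ≤ z.im ∧ z.im ≤ b})
    (hd : DifferentiableOn ℂ g {z | 0 < z.im ∧ z.im < b}) (h0 : ∀ t : ℝ, g t = 0) :
    EqOn g 0 {z | 0 ≤ z.im ∧ z.im ≤ b} := by
  have hU : {z : ℂ | 0 < z.im ∧ z.im < b} = Complex.im ⁻¹' Ioo 0 b := rfl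
  have hS : {z : ℂ | 0 ≤ z.im ∧ z.im ≤ b} = Complex.im ⁻¹' Icc 0 b := rfl
  have hUo : IsOpen (Complex.im ⁻¹' Ioo 0 b) := isOpen_Ioo.preimage Complex.continuous_im
  rw [hU] at hd
  rw [hS]
  have hin : EqOn g 0 (Complex.im ⁻¹' Ioo 0 b) := by
    refine (hd.analyticOnNhd hUo).eqOn_zero_of_preconnected_of_eventuallyEq_zero
      (z₀ := (b / 4 : ℝ) * Complex.I) ?_ ?_ ?_
    · exact ((convex_Ioo 0 b).is_linear_preimage
        Complex.imLm.isLinear).isPreconnected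
    · simp; constructor <;> linarith
    · have : Complex.im ⁻¹' Ioo 0 (b / 2) ∈ 𝓝 ((b / 4 : ℝ) * Complex.I) := by
        refine (isOpen_Ioo.preimage Complex.continuous_im).mem_nhds ?_
        simp; constructor <;> linarith
      filter_upwards [this] with z hz
      exact eq_zero_of_eq_zero_on_real hc hd h0 hz.1 (by linarith [hz.2])
  refine hin.of_subset_closure hc continuousOn_const (preimage_mono Ioo_subset_Icc_self) ?_
  rw [Complex.closure_preimage_im, closure_Ioo hb.ne]

/-! ### Boundary values and the KMS condition -/

/-- The function `p ↦ (1 - ip)ⁿ exp (-ap)`, inverse to `p ↦ exp (ap) (1 - ip)⁻ⁿ`. -/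
noncomputable def wex (n : ℕ) (a : ℝ) (p : ℝ) : ℂ := conj (wt n p) * ex (-a) p

theorem continuous_wex (n : ℕ) (a : ℝ) : Continuous (wex n a) :=
  (Complex.continuous_conj.comp (continuous_wt n)).mul (continuous_ex _)

theorem wex_mul (n : ℕ) (a : ℝ) : wex n a * (ex a * iw n) = fun _ => 1 := by
  funext p
  have h1 := congrFun (ex_add (-a) a) p
  rw [neg_add_cancel, ex_zero] at h1
  simp only [Pi.mul_apply, Pi.one_apply] at h1
  have h2 := conj_wt_mul_iw n p
  simp only [wex, Pi.mul_apply]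
  calc _ = (conj (wt n p) * iw n p) * (ex (-a) p * ex a p) := by ring
    _ = 1 := by rw [h2, ← h1, mul_one]

theorem conj_wex_neg (n : ℕ) (a : ℝ) (p : ℝ) : conj (wex n a (-p)) = wex n (-a) p := by
  have := conj_ex_neg (-a) p
  push_cast at this
  rw [wex, wex, map_mul, this, Complex.conj_conj, ← conj_wt_neg n p, Complex.conj_conj]
  push_cast
  rfl

theorem wex_neg_mul_ex (n : ℕ) (a : ℝ) : wex n (-a) * ex (-(2 * a)) = wex n a := by
  funext p
  have := congrFun (ex_add (-((-a : ℝ) : ℂ)) (-(2 * a))) p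
  rw [Pi.mul_apply, wex, mul_assoc, wex]
  rw [Pi.mul_apply] at this
  rw [← this]
  congr 2
  push_cast
  ring

namespace AntiunitaryRep

variable {H : Type*} [NormedAddCommGroup H] [InnerProductSpace ℂ H] [CompleteSpace H]
  {ρ : AntiunitaryRep H} {v : H} {n : ℕ} {a : ℝ}

theorem continuous_wtDist (n : ℕ) : Continuous (ρ.wtDist n) := by
  refine PointwiseConvergenceCLM.continuous_of_continuous_eval fun φ => ?_
  simp only [wtDist_apply]
  exact continuous_const.inner continuous_id

theorem distU_wtDist (t : ℝ) (n : ℕ) (x : H) :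
    ρ.distU t (ρ.wtDist n x) = ρ.wtDist n (ρ.U t x) := by
  apply ContinuousLinearMap.ext
  intro φ
  change ρ.distU t (ρ.wtDist n x) φ = ρ.wtDist n (ρ.U t x) φ
  have h : ρ.smoothIncl (ρ.smoothU (-t) φ) = ρ.U (-t) (ρ.smoothIncl φ) := rfl
  have h1 := ρ.inner_U_U (-t) 0 (ρ.fc (wt n) (ρ.smoothIncl φ)) x
  rw [U_zero, zero_sub, neg_neg] at h1
  rw [distU_apply, wtDist_apply, wtDist_apply, h, fc_U, h1]

theorem fc_wt_J (n : ℕ) (φ : ρ.SmoothVectors) :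
    ρ.fc (wt n) (ρ.J (ρ.smoothIncl φ)) = ρ.J (ρ.fc (wt n) (ρ.smoothIncl φ)) := by
  rw [J_fc (continuous_wt n).measurable (memLp_wt φ n)]
  simp only [conj_wt_neg]

theorem distJ_wtDist (n : ℕ) (x : H) : ρ.distJ (ρ.wtDist n x) = ρ.wtDist n (ρ.J x) := by
  apply ContinuousLinearMap.ext
  intro φ
  change ρ.distJ (ρ.wtDist n x) φ = ρ.wtDist n (ρ.J x) φ
  have h : ρ.smoothIncl (ρ.smoothJ φ) = ρ.J (ρ.smoothIncl φ) := rfl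
  rw [distJ_apply, wtDist_apply, wtDist_apply, h, fc_wt_J, inner_conj_symm]
  conv_lhs => rw [← ρ.J_J x, inner_J_J]

theorem memLp_ex_iw_mono {m n : ℕ} (hmn : m ≤ n) (h : MemLp (ex a * iw m) 2 (ρ.specMeasure v)) :
    MemLp (ex a * iw n) 2 (ρ.specMeasure v) := by
  refine h.of_le ((continuous_ex _).mul (continuous_iw n)).aestronglyMeasurable
    (ae_of_all _ fun p => ?_)
  rw [Pi.mul_apply, Pi.mul_apply, norm_mul, norm_mul]
  exact mul_le_mul_of_nonneg_left (norm_iw_anti hmn p) (norm_nonneg _)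

/-- In the interior of the strip the polynomial weight is absorbed by the exponential. -/
theorem memLp_ex_of_abs_lt (hp : MemLp (ex a * iw n) 2 (ρ.specMeasure v))
    (hm : MemLp (ex (-a) * iw n) 2 (ρ.specMeasure v)) {t : ℝ} (ht : |t| < a) :
    MemLp (ex t) 2 (ρ.specMeasure v) := by
  obtain ⟨C, hC, hw⟩ := exists_norm_wt_le_exp n (sub_pos.2 ht)
  refine ((memLp_strip_bound hp hm).const_mul C).mono' (continuous_ex _).aestronglyMeasurable
    (ae_of_all _ fun p => ?_)
  have h1 : Real.exp (t * p) ≤ Real.exp (|t| * |p|) := by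
    rw [← abs_mul]; exact Real.exp_le_exp.2 (le_abs_self _)
  have h2 : Real.exp (a * |p|) ≤ Real.exp (a * p) + Real.exp (-a * p) := by
    refine le_trans (Real.exp_le_exp.2 ?_) ((exp_abs_le (a * p)).trans_eq (by rw [neg_mul]))
    rw [abs_mul]
    exact mul_le_mul_of_nonneg_right (le_abs_self a) (abs_nonneg p)
  have hpos : 0 < ‖wt n p‖ := norm_pos_iff.2 (wt_ne_zero n p)
  rw [norm_ex, Complex.ofReal_re, norm_iw, ← mul_assoc, ← div_eq_mul_inv, le_div_iff₀ hpos]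
  calc Real.exp (t * p) * ‖wt n p‖
      ≤ Real.exp (|t| * |p|) * (C * Real.exp ((a - |t|) * |p|)) :=
        mul_le_mul h1 (hw p) (norm_nonneg _) (Real.exp_pos _).le
    _ = C * Real.exp (a * |p|) := by
        rw [mul_left_comm, ← Real.exp_add]
        congr 2
        ring
    _ ≤ C * (Real.exp (a * p) + Real.exp (-a * p)) := mul_le_mul_of_nonneg_left h2 hC.le

theorem expA_eq {t : ℝ} (h : MemLp (ex t) 2 (ρ.specMeasure v)) :
    ρ.spectral.expA t v = ρ.fc (ex t) v := integral_spectral h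

theorem tendsto_embed_expA (hp : MemLp (ex (Real.pi / 2 : ℝ) * iw n) 2 (ρ.specMeasure v))
    (hm : MemLp (ex (-(Real.pi / 2 : ℝ)) * iw n) 2 (ρ.specMeasure v)) :
    Tendsto (fun t : ℝ => ρ.embed (ρ.spectral.expA t v)) (𝓝[<] (Real.pi / 2))
      (𝓝 (ρ.wtDist n (ρ.fc (ex (Real.pi / 2 : ℝ) * iw n) v))) := by
  have hpi := Real.pi_pos
  have hc := continuousOn_fc_ex (continuous_iw n).measurable hp hm
    ((Real.pi / 2 : ℝ) : ℂ) (by simp [abs_of_pos (half_pos hpi)])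
  have hin : ∀ᶠ t : ℝ in 𝓝[<] (Real.pi / 2), |t| < Real.pi / 2 := by
    filter_upwards [Ioo_mem_nhdsLT (show -(Real.pi / 2) < Real.pi / 2 by linarith)] with t ht
    exact abs_lt.2 ht
  have h1 : Tendsto (fun t : ℝ => (t : ℂ)) (𝓝[<] (Real.pi / 2))
      (𝓝[{s : ℂ | |s.re| ≤ Real.pi / 2}] ((Real.pi / 2 : ℝ) : ℂ)) := by
    refine tendsto_nhdsWithin_iff.2 ⟨(Complex.continuous_ofReal.tendsto _).mono_left
      nhdsWithin_le_nhds, ?_⟩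
    filter_upwards [hin] with t ht
    simpa using ht.le
  refine (((continuous_wtDist n).tendsto _).comp (hc.tendsto.comp h1)).congr' ?_
  filter_upwards [hin] with t ht
  have h2 := memLp_ex_of_abs_lt hp hm ht
  rw [expA_eq h2, embed_fc (continuous_ex _).measurable h2 n, mul_comm]
  rfl

theorem betaPlus_eq (hp : MemLp (ex (Real.pi / 2 : ℝ) * iw n) 2 (ρ.specMeasure v))
    (hm : MemLp (ex (-(Real.pi / 2 : ℝ)) * iw n) 2 (ρ.specMeasure v)) :
    ρ.spectral.betaPlus ρ v = ρ.wtDist n (ρ.fc (ex (Real.pi / 2 : ℝ) * iw n) v) :=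
  (tendsto_embed_expA hp hm).limUnder_eq

/-- The extension of the orbit map of `β⁺(v)` to the strip is `z ↦ exp ((π/2 + iz) A) v`. -/
theorem wtDist_mem_kmsVectors (hv : ρ.J v = v)
    (hp : MemLp (ex (Real.pi / 2 : ℝ) * iw n) 2 (ρ.specMeasure v))
    (hm : MemLp (ex (-(Real.pi / 2 : ℝ)) * iw n) 2 (ρ.specMeasure v)) :
    ρ.wtDist n (ρ.fc (ex (Real.pi / 2 : ℝ) * iw n) v) ∈ ρ.kmsVectors := by
  have him := (continuous_iw n).measurable
  have hre : ∀ z : ℂ, (((Real.pi / 2 : ℝ) : ℂ) + Complex.I * z).re = Real.pi / 2 - z.im := by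
    intro z
    rw [Complex.add_re, Complex.ofReal_re]
    simp
    ring
  refine ⟨fun z => ρ.wtDist n (ρ.fc (ex ((Real.pi / 2 : ℝ) + Complex.I * z) * iw n) v),
    ?_, fun φ => ?_, fun t => ?_, ?_⟩
  · refine (continuous_wtDist n).comp_continuousOn
      ((continuousOn_fc_ex him hp hm).comp (by fun_prop) fun z hz => ?_)
    rw [mem_ofPred_eq, hre, abs_le]
    constructor <;> linarith [hz.1, hz.2]
  · intro z hz
    simp only [wtDist_apply]
    have h1 : |(((Real.pi / 2 : ℝ) : ℂ) + Complex.I * z).re| < Real.pi / 2 := by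
      rw [hre, abs_lt]
      constructor <;> linarith [hz.1, hz.2]
    have h2 := (differentiableAt_fc_ex him hp hm h1).comp z
      (f := fun z => ((Real.pi / 2 : ℝ) : ℂ) + Complex.I * z) (by fun_prop)
    exact ((innerSL ℂ (ρ.fc (wt n) (ρ.smoothIncl φ))).differentiableAt.comp z
      h2).differentiableWithinAt
  · have h1 : ex (Complex.I * t) = expChar t := rfl
    simp only
    rw [distU_wtDist, U_fc hp, ← mul_assoc, ← h1, ← ex_add, add_comm]
  · simp only
    rw [distJ_wtDist, J_fc ((continuous_ex _).mul (continuous_iw n)).measurable hp, hv]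
    congr 2
    funext p
    simp only [Pi.mul_apply, map_mul, conj_iw_neg, conj_ex_neg]
    congr 2
    rw [mul_left_comm, Complex.I_mul_I]
    push_cast
    ring

theorem fc_wex_fc (hp : MemLp (ex a * iw n) 2 (ρ.specMeasure v)) :
    ρ.fc (wex n a) (ρ.fc (ex a * iw n) v) = v := by
  rw [fc_fc ((continuous_ex _).mul (continuous_iw n)).measurable (continuous_wex n a).measurable hp
    (by rw [wex_mul]; exact memLp_const 1), wex_mul, fc_one]

/-- If `η = (1 - iA)ⁿ u` satisfies the KMS condition, then `J u = exp (-πA) u` on all bounded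
spectral subspaces: pairing the extended orbit map with vectors of bounded spectral support gives
entire functions, so that boundary uniqueness determines its value at `πi`. -/
theorem fc_cutoff_J_eq {u : H} (h : ρ.wtDist n u ∈ ρ.kmsVectors) (R : ℕ) :
    ρ.fc (cutoff R) (ρ.J u) = ρ.fc (cutoff R * ex (-Real.pi)) u := by
  obtain ⟨F, hFc, hFd, hFr, hFπ⟩ := h
  have hcm := measurable_cutoff R
  have hadj : ∀ x y : H, inner ℂ (ρ.fc (cutoff R) x) y = inner ℂ x (ρ.fc (cutoff R) y) := by
    intro x y
    rw [inner_fc_right (memLp_of_norm_le hcm (norm_cutoff_le R))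
      (memLp_of_norm_le hcm (norm_cutoff_le R))]
    simp only [cutoff, conj_ind]
  have hmem : ∀ s : ℂ, MemLp (ex s * cutoff R) 2 (ρ.specMeasure u) := fun s => by
    rw [mul_comm]; exact memLp_cutoff_mul (continuous_ex s) R
  refine ext_inner_left ℂ fun x => ?_
  set φ := ρ.cutVec n R x with hφ
  have hpair : ∀ y, ρ.wtDist n y φ = inner ℂ x (ρ.fc (cutoff R) y) := fun y => by
    rw [wtDist_apply, fc_wt_cutVec, hadj]
  have hre : ∀ z : ℂ, (Complex.I * z).re = -z.im := fun z => by simp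
  have hdiff : ∀ z : ℂ, z.im ∈ Icc 0 Real.pi →
      DifferentiableAt ℂ (fun z => inner ℂ x (ρ.fc (ex (Complex.I * z) * cutoff R) u)) z := by
    intro z hz
    have h1 : |(Complex.I * z).re| < Real.pi + 1 := by
      rw [hre, abs_neg, abs_of_nonneg hz.1]; linarith [hz.2]
    have h2 := (differentiableAt_fc_ex (a := Real.pi + 1) hcm (hmem _) (hmem _) h1).comp z
      (f := fun z => Complex.I * z) (by fun_prop)
    exact (innerSL ℂ x).differentiableAt.comp z h2
  have hzero := eqOn_zero_of_eq_zero_on_real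
    (g := fun z => F z φ - inner ℂ x (ρ.fc (ex (Complex.I * z) * cutoff R) u)) Real.pi_pos
    (ContinuousOn.sub ((continuous_eval_const φ).comp_continuousOn hFc)
      fun z hz => (hdiff z hz).continuousAt.continuousWithinAt)
    (DifferentiableOn.sub (hFd φ) fun z hz =>
      (hdiff z ⟨hz.1.le, hz.2.le⟩).differentiableWithinAt)
    (fun t => by
      have h1 : ex (Complex.I * t) = expChar t := rfl
      rw [hFr, distU_wtDist, hpair, fc_U, U_fc (memLp_of_norm_le hcm (norm_cutoff_le R)), h1,
        sub_self])
    (x := Real.pi * Complex.I) (by simp [Real.pi_pos.le])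
  have hI : Complex.I * (Real.pi * Complex.I) = -(Real.pi : ℂ) := by
    rw [mul_left_comm, Complex.I_mul_I]; ring
  simp only [Pi.zero_apply] at hzero
  rw [hFπ, distJ_wtDist, hpair, hI, sub_eq_zero] at hzero
  rw [hzero, mul_comm]

/-- By `fc_cutoff_J_eq`, the norms of the truncations of `exp (-πA) u` are bounded by `‖J u‖`, so
Fatou's lemma puts `u` in the domain of `exp (-πA)`. -/
theorem memLp_ex_neg_pi {u : H} (h : ρ.wtDist n u ∈ ρ.kmsVectors) :
    MemLp (ex (-Real.pi)) 2 (ρ.specMeasure u) := by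
  refine ⟨(continuous_ex _).aestronglyMeasurable, ?_⟩
  have hmem := fun R : ℕ =>
    memLp_cutoff_mul (μ := ρ.specMeasure u) (continuous_ex (-Real.pi)) R
  have h1 := ENNReal.tendsto_ofReal (tendsto_fc_cutoff_self (ρ := ρ) (ρ.J u)).norm
  have h2 : ∀ R : ℕ, ENNReal.ofReal ‖ρ.fc (cutoff R) (ρ.J u)‖ =
      eLpNorm (cutoff R * ex (-Real.pi)) 2 (ρ.specMeasure u) := fun R => by
    rw [fc_cutoff_J_eq h, norm_fc (hmem R), ENNReal.ofReal_toReal (hmem R).2.ne]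
  simp only [h2] at h1
  refine (Lp.eLpNorm_lim_le_liminf_eLpNorm (fun R => (hmem R).1) _
    (ae_of_all _ fun p => ?_)).trans_lt (h1.liminf_eq.trans_lt ENNReal.ofReal_lt_top)
  simpa using (tendsto_cutoff p).mul_const (ex (-Real.pi) p)

theorem J_eq_fc_ex_neg_pi {u : H} (h : ρ.wtDist n u ∈ ρ.kmsVectors) :
    ρ.J u = ρ.fc (ex (-Real.pi)) u := by
  refine tendsto_nhds_unique (tendsto_fc_cutoff_self (ρ := ρ) (ρ.J u)) ?_
  simp only [fc_cutoff_J_eq h]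
  exact tendsto_fc_cutoff (continuous_ex _).measurable (memLp_ex_neg_pi h)

/-- If `u` is in the domain of `exp (-πA)`, it is in that of `(1 - iA)ⁿ exp (-πA/2)`, because
`|1 - ip|ⁿ exp (-πp/2) ≤ C exp (π|p|/2) exp (-πp/2) ≤ C (1 + exp (-πp))`. -/
theorem memLp_wex {u : H} (n : ℕ) (h : MemLp (ex (-Real.pi)) 2 (ρ.specMeasure u)) :
    MemLp (wex n (Real.pi / 2)) 2 (ρ.specMeasure u) := by
  obtain ⟨C, hC, hw⟩ := exists_norm_wt_le_exp n (half_pos Real.pi_pos)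
  have h1 : MemLp (fun _ : ℝ => (1 : ℝ)) 2 (ρ.specMeasure u) := memLp_const 1
  refine ((h1.add h.norm).const_mul C).mono' (continuous_wex _ _).aestronglyMeasurable
    (ae_of_all _ fun p => ?_)
  have h2 : Real.exp (Real.pi / 2 * |p|) ≤
      Real.exp (Real.pi / 2 * p) + Real.exp (-(Real.pi / 2 * p)) := by
    refine le_trans (Real.exp_le_exp.2 ?_) (exp_abs_le (Real.pi / 2 * p))
    rw [abs_mul, abs_of_pos (half_pos Real.pi_pos)]
  rw [wex, norm_mul, RCLike.norm_conj, norm_ex]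
  simp only [Pi.add_apply, norm_ex]
  calc ‖wt n p‖ * Real.exp ((-((Real.pi / 2 : ℝ) : ℂ)).re * p)
      ≤ C * (Real.exp (Real.pi / 2 * p) + Real.exp (-(Real.pi / 2 * p))) *
          Real.exp ((-((Real.pi / 2 : ℝ) : ℂ)).re * p) :=
        mul_le_mul_of_nonneg_right ((hw p).trans (mul_le_mul_of_nonneg_left h2 hC.le))
          (Real.exp_pos _).le
    _ = C * (1 + Real.exp ((-(Real.pi : ℂ)).re * p)) := by
        rw [mul_assoc, add_mul, ← Real.exp_add, ← Real.exp_add, ← Real.exp_zero]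
        simp only [Complex.neg_re, Complex.ofReal_re]
        congr 3 <;> ring_nf

/-- The preimage of a KMS vector `η = (1 - iA)ⁿ u` is `v = (1 - iA)ⁿ exp (-πA/2) u`. -/
theorem exists_betaPlus_eq {η : ρ.DistVectors} (h : η ∈ ρ.kmsVectors) :
    ∃ v ∈ ρ.spectral.tempVectors ρ, ρ.spectral.betaPlus ρ v = η := by
  obtain ⟨n, u, rfl⟩ := exists_eq_wtDist η
  have hex := memLp_ex_neg_pi h
  have hJ := J_eq_fc_ex_neg_pi h
  have hf := memLp_wex n hex
  have hfm := (continuous_wex n (Real.pi / 2)).measurable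
  have hmul : wex n (-(Real.pi / 2)) * ex (-Real.pi) = wex n (Real.pi / 2) := by
    have := wex_neg_mul_ex n (Real.pi / 2)
    rw [← this]
    congr 2
    push_cast
    ring
  have hinv : ex (Real.pi / 2 : ℝ) * iw n * wex n (Real.pi / 2) = fun _ => 1 := by
    rw [mul_comm]; exact wex_mul n _
  have hJv : ρ.J (ρ.fc (wex n (Real.pi / 2)) u) = ρ.fc (wex n (Real.pi / 2)) u := by
    rw [J_fc hfm hf]
    simp only [conj_wex_neg]
    change ρ.fc (wex n (-(Real.pi / 2))) (ρ.J u) = _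
    rw [hJ, fc_fc (continuous_ex _).measurable (continuous_wex _ _).measurable hex
      (by rwa [hmul]), hmul]
  have hem := ((continuous_ex (Real.pi / 2 : ℝ)).mul (continuous_iw n)).measurable
  have hp : MemLp (ex (Real.pi / 2 : ℝ) * iw n) 2
      (ρ.specMeasure (ρ.fc (wex n (Real.pi / 2)) u)) :=
    (memLp_specMeasure_fc_iff hfm hf hem).2 (by
      exact hinv ▸ memLp_const 1)
  refine ⟨_, mem_tempVectors_iff.2 ⟨hJv, n, hp⟩, ?_⟩
  rw [betaPlus_eq hp (memLp_ex_neg_of_J_fixed hJv hp), fc_fc hfm hem hf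
    (by exact hinv ▸ memLp_const 1)]
  have hinv' : (ex (Real.pi / 2 : ℝ) * iw n) * wex n (Real.pi / 2) = fun _ => 1 := hinv
  rw [hinv', fc_one]

/-- A vector `v` is recovered from `u` in `β⁺(v) = (1 - iA)ⁿ u`, and any two vectors of
`tempVectors` admit a common exponent `n`. -/
theorem injOn_betaPlus : InjOn (ρ.spectral.betaPlus ρ) (ρ.spectral.tempVectors ρ) := by
  intro v hv w hw hvw
  obtain ⟨hJv, n, hn⟩ := mem_tempVectors_iff.1 hv
  obtain ⟨hJw, m, hm⟩ := mem_tempVectors_iff.1 hw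
  have h1 := memLp_ex_iw_mono (le_max_left n m) hn
  have h2 := memLp_ex_iw_mono (le_max_right n m) hm
  rw [betaPlus_eq h1 (memLp_ex_neg_of_J_fixed hJv h1),
    betaPlus_eq h2 (memLp_ex_neg_of_J_fixed hJw h2)] at hvw
  have h3 := wtDist_injective _ hvw
  rw [← fc_wex_fc h1, h3, fc_wex_fc h2]

end AntiunitaryRep

theorem mainTheorem6 {H : Type*} [NormedAddCommGroup H] [InnerProductSpace ℂ H] [CompleteSpace H]
    (ρ : AntiunitaryRep H) :
    (∃! P : SpectralMeasure H, P.Represents ρ) ∧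
    ∀ P : SpectralMeasure H, P.Represents ρ →
      (∀ v ∈ P.tempVectors ρ,
        (∀ t ∈ Set.Ioo (-(Real.pi / 2)) (Real.pi / 2), P.MemDomainExp t v) ∧
        Filter.Tendsto (fun t : ℝ => ρ.embed (P.expA t v)) (nhdsWithin (Real.pi / 2)
          (Set.Iio (Real.pi / 2))) (nhds (P.betaPlus ρ v))) ∧
      Set.BijOn (P.betaPlus ρ) (P.tempVectors ρ) ρ.kmsVectors := by
  refine ⟨⟨ρ.spectral, AntiunitaryRep.spectral_represents,
    fun P hP => hP.eq AntiunitaryRep.spectral_represents⟩, fun P hP => ?_⟩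
  obtain rfl : P = ρ.spectral := hP.eq AntiunitaryRep.spectral_represents
  refine ⟨fun v hv => ?_, fun v hv => ?_, AntiunitaryRep.injOn_betaPlus,
    fun η hη => AntiunitaryRep.exists_betaPlus_eq hη⟩
  · obtain ⟨hJv, n, hp⟩ := AntiunitaryRep.mem_tempVectors_iff.1 hv
    have hm := AntiunitaryRep.memLp_ex_neg_of_J_fixed hJv hp
    refine ⟨fun t ht => ?_, ?_⟩
    · have := AntiunitaryRep.memLp_ex_of_abs_lt hp hm (abs_lt.2 ht)
      rw [SpectralMeasure.MemDomainExp, SpectralMeasure.MemDomain,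
        AntiunitaryRep.measure_spectral]
      exact this
    · rw [AntiunitaryRep.betaPlus_eq hp hm]
      exact AntiunitaryRep.tendsto_embed_expA hp hm
  · obtain ⟨hJv, n, hp⟩ := AntiunitaryRep.mem_tempVectors_iff.1 hv
    have hm := AntiunitaryRep.memLp_ex_neg_of_J_fixed hJv hp
    rw [AntiunitaryRep.betaPlus_eq hp hm]
    exact AntiunitaryRep.wtDist_mem_kmsVectors hJv hp hm
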